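/- **Theorem 5.14.** All graphs are finite, simple and undirected. For a graph $G$ let $F(G)$ be the number of connected subgraphs of $G$ (a subgraph consists of a nonempty set of vertices of $G$ and a set of edges of $G$ between them; it need not be induced). A pendant vertex is a vertex of degree one. Let $C_n$ be the cycle on $n$ vertices. For $n\ge 6$ let $C^n_{3,3}$ be the graph on $n$ vertices obtained from a path on $n-4$ vertices by identifying one end of the path with a vertex of a triangle and the other end with a vertex of another, disjoint triangle. Let $n\ge 3$ and let $G$ be a connected graph on $n$ vertices with no pendant vertices. Then $$F(G)\ \ge\ \begin{cases} F(C_n), & \text{if } n\le 16,\\ F(C^n_{3,3}), & \text{if } n>16.\end{cases}$$ Moreover, $F(G)\ge \min\left\{n^2+1,\ \dfrac{n^2+17n}{2}\right\}$. -/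

import Mathlib

/-- The core index `F(G)`: the number of connected subgraphs of `G`. A subgraph is a set of
vertices together with a set of edges of `G` between them (not necessarily induced), and a connected
subgraph has at least one vertex. -/
noncomputable def coreIndex {V : Type*} (G : SimpleGraph V) : ℕ :=
  {H : G.Subgraph | H.Connected}.ncard

/-- A pendant vertex is a vertex of degree one. -/
def IsPendant {V : Type*} [Fintype V] (G : SimpleGraph V) [DecidableRel G.Adj] (v : V) : Prop :=
  G.degree v = 1

/-- For `m₁, m₂ ≥ 3` and `n ≥ m₁ + m₂ - 1`, the graph `C^n_{m₁,m₂}` on `n` vertices: a cycle on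
`m₁` vertices and a cycle on `m₂` vertices joined by a path whose two ends are identified with a
vertex of each (if `n = m₁ + m₂ - 1`, the two cycles share one vertex).
The vertices are `0, …, n-1`, consecutive vertices are adjacent, the edge `{0, m₁-1}` closes the
cycle on `0, …, m₁-1`, and the edge `{n-m₂, n-1}` closes the cycle on `n-m₂, …, n-1`. The joining
path is `m₁-1, …, n-m₂`, with `n - (m₁+m₂) + 2` vertices. -/
def twoCycleGraph (m₁ m₂ n : ℕ) : SimpleGraph (Fin n) :=
  SimpleGraph.fromRel fun i j =>
    i.val + 1 = j.val ∨
    (i.val = 0 ∧ j.val + 1 = m₁) ∨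
    (i.val + m₂ = n ∧ j.val + 1 = n)

/-! Everything is compared with two explicit numbers. The candidates satisfy F(C_n) ≤ n² + 1 and
2F(C^n_{3,3}) ≤ n² + 17n (`coreIndex_cycleGraph_le`, `two_mul_coreIndex_twoCycleGraph_le`), while
every admissible G satisfies F(G) ≥ n² + 1 or 2F(G) ≥ n² + 17n. For n ≥ 3 the first number is the
smaller one exactly when n ≤ 16.

The lower bound is an induction by contraction. If v and a are adjacent without a common neighbour,
the connected subgraphs of K/va pull back injectively to connected subgraphs of K that contain
neither of v, a or the whole edge va. Hence F(K) exceeds F(K/va) by at least the number of connected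
subgraphs through v without the edge va plus the number of those through a without v
(`contract_add_le`). These gains are rooted counts. Through a fixed vertex of a connected n-vertex
graph there are at least n, n + 4 or n + 9 connected subgraphs, according as there are at least n -
1, n or n + 1 edges (`ncard_verts_le_connAt`, `add_four_le_connAt`, `add_nine_le_connAt`).

Minimum degree two forces at least n edges. With exactly n edges the graph is 2-regular and each
contraction gains n + (n - 1), which gives n² + 1 (`sq_add_one_le_connIn`). With more edges, delete
non-bridges until n + 1 remain; minimum degree plays no further role, and a gain of n + 8 is needed.
A bridge supplies it, since the two sides share cyclomatic number two. Without bridges, a degree-two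
vertex with nonadjacent neighbours supplies it; if there is none, at most five vertices remain
(`no_reduced_bicyclic`). The base on five vertices is the finite check `check_five`. It yields 54
where the formula asks for 55, so the step to six vertices must gain one more. This estimate falls
short only for two triangles joined by an edge, which are counted directly
(`le_connIn_of_bicyclic`).

For the upper bounds, a connected subgraph of a path is determined by its two ends. A cycle is cut
open at a missing edge, and a pendant triangle is peeled off at the vertex where it is attached. -/

open Relation

/-! ### Connected subgraphs: reachability, gluing, deletion. -/

namespace CoreIndex

variable {V : Type*} {Γ : SimpleGraph V}

/-- The connected subgraphs contained in `K`. -/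
def connIn (K : Γ.Subgraph) : Set Γ.Subgraph := {S | S ≤ K ∧ S.Connected}

/-- The connected subgraphs contained in `K` that contain the vertex `u`. -/
def connAt (u : V) (K : Γ.Subgraph) : Set Γ.Subgraph := {S | S ≤ K ∧ S.Connected ∧ u ∈ S.verts}

/-- The ordered pairs of adjacent vertices, so that every edge is counted twice. -/
def darts (K : Γ.Subgraph) : Set (V × V) := {p | K.Adj p.1 p.2}

theorem connAt_subset (u : V) (K : Γ.Subgraph) : connAt u K ⊆ connIn K := fun _ h => ⟨h.1, h.2.1⟩

/-- Connectedness is traded for `ReflTransGen` of adjacency on the ambient vertex type, so that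
different subgraphs can be compared without subtypes. -/
theorem connected_of_root {S : Γ.Subgraph} {r : V} (hr : r ∈ S.verts)
    (h : ∀ x ∈ S.verts, ReflTransGen S.Adj r x) : S.Connected := by
  have key : ∀ x (hx : ReflTransGen S.Adj r x), ∃ hx' : x ∈ S.verts,
      S.coe.Reachable ⟨r, hr⟩ ⟨x, hx'⟩ := by
    intro x hx
    induction hx with
    | refl => exact ⟨hr, SimpleGraph.Reachable.refl _⟩
    | tail _ hbc ih =>
      obtain ⟨hb, hreach⟩ := ih
      refine ⟨S.edge_vert hbc.symm, hreach.trans ?_⟩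
      exact SimpleGraph.Adj.reachable (by simpa using hbc)
  rw [SimpleGraph.Subgraph.connected_iff']
  have : Nonempty S.verts := ⟨⟨r, hr⟩⟩
  refine SimpleGraph.Connected.mk fun a b => ?_
  obtain ⟨_, ha⟩ := key a (h a a.2)
  obtain ⟨_, hb⟩ := key b (h b b.2)
  exact ha.symm.trans hb

theorem reach {S : Γ.Subgraph} (hS : S.Connected) {x y : V} (hx : x ∈ S.verts) (hy : y ∈ S.verts) :
    ReflTransGen S.Adj x y := by
  rw [SimpleGraph.Subgraph.connected_iff'] at hS
  have := (SimpleGraph.reachable_iff_reflTransGen _ _).1 (hS.preconnected ⟨x, hx⟩ ⟨y, hy⟩)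
  exact this.lift (fun z : S.verts => (z : V)) (fun a b hab => by simpa using hab)

theorem reflTransGen_symm {S : Γ.Subgraph} {x y : V} (h : ReflTransGen S.Adj x y) :
    ReflTransGen S.Adj y x := by
  induction h with
  | refl => exact .refl
  | tail _ hbc ih => exact .head hbc.symm ih

/-- A set that is closed under adjacency and meets a connected subgraph contains it. -/
theorem subset_of_closed {S : Γ.Subgraph} (hS : S.Connected) {X : Set V} {r : V}
    (hr : r ∈ S.verts) (hrX : r ∈ X) (hX : ∀ x y, S.Adj x y → x ∈ X → y ∈ X) : S.verts ⊆ X := by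
  intro y hy
  have := reach hS hr hy
  induction this with
  | refl => exact hrX
  | tail _ hbc ih => exact hX _ _ hbc (ih (S.edge_vert hbc))

theorem exists_adj_of_connected {S : Γ.Subgraph} (hS : S.Connected) {x y : V} (hx : x ∈ S.verts)
    (hy : y ∈ S.verts) (hxy : x ≠ y) : ∃ z, S.Adj x z := by
  rcases (reach hS hx hy).cases_head with h | ⟨z, hz, _⟩
  · exact absurd h hxy
  · exact ⟨z, hz⟩

/-- The subgraph obtained from `R` by joining a vertex `w` to all vertices in `A`. -/
def addStar (R : Γ.Subgraph) (w : V) (A : Set V) (hA : A ⊆ Γ.neighborSet w) : Γ.Subgraph where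
  verts := insert w (R.verts ∪ A)
  Adj p q := R.Adj p q ∨ (p = w ∧ q ∈ A) ∨ (q = w ∧ p ∈ A)
  adj_sub := by
    rintro p q (h | ⟨rfl, h⟩ | ⟨rfl, h⟩)
    · exact R.adj_sub h
    · exact hA h
    · exact (hA h).symm
  edge_vert := by
    rintro p q (h | ⟨rfl, h⟩ | ⟨rfl, h⟩)
    · exact Or.inr (Or.inl (R.edge_vert h))
    · exact Or.inl rfl
    · exact Or.inr (Or.inr h)
  symm := ⟨by
    rintro p q (h | ⟨rfl, h⟩ | ⟨rfl, h⟩)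
    · exact Or.inl h.symm
    · exact Or.inr (Or.inr ⟨rfl, h⟩)
    · exact Or.inr (Or.inl ⟨rfl, h⟩)⟩

theorem addStar_adj {R : Γ.Subgraph} {w : V} {A : Set V} {hA : A ⊆ Γ.neighborSet w} {p q : V} :
    (addStar R w A hA).Adj p q ↔ R.Adj p q ∨ (p = w ∧ q ∈ A) ∨ (q = w ∧ p ∈ A) := Iff.rfl

theorem mem_addStar {R : Γ.Subgraph} {w : V} {A : Set V} {hA : A ⊆ Γ.neighborSet w} {p : V} :
    p ∈ (addStar R w A hA).verts ↔ p = w ∨ p ∈ R.verts ∨ p ∈ A := Iff.rfl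

theorem addStar_connected {R : Γ.Subgraph} {w : V} {A : Set V} {hA : A ⊆ Γ.neighborSet w}
    (hR : R.Connected) {x : V} (hx : x ∈ A) (hxR : x ∈ R.verts) :
    (addStar R w A hA).Connected := by
  refine connected_of_root (r := w) (Or.inl rfl) ?_
  rintro p (rfl | hp | hp)
  · exact .refl
  · refine .head (b := x) (Or.inr (Or.inl ⟨rfl, hx⟩)) ?_
    exact ReflTransGen.mono (fun _ _ h => Or.inl h) _ _ (reach hR hxR hp)
  · exact .single (Or.inr (Or.inl ⟨rfl, hp⟩))

theorem addStar_le {R K : Γ.Subgraph} {w : V} {A : Set V} {hA : A ⊆ Γ.neighborSet w}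
    (hR : R ≤ K) (hw : w ∈ K.verts) (hAK : A ⊆ K.neighborSet w) : addStar R w A hA ≤ K := by
  refine ⟨?_, ?_⟩
  · rintro p (rfl | hp | hp)
    · exact hw
    · exact hR.1 hp
    · exact K.edge_vert (hAK hp).symm
  · rintro p q (h | ⟨rfl, h⟩ | ⟨rfl, h⟩)
    · exact hR.2 h
    · exact hAK h
    · exact (hAK h).symm

/-- The deletion of a single vertex. -/
abbrev del (K : Γ.Subgraph) (w : V) : Γ.Subgraph := K.deleteVerts {w}

theorem del_adj {K : Γ.Subgraph} {w p q : V} : (del K w).Adj p q ↔ K.Adj p q ∧ p ≠ w ∧ q ≠ w := by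
  rw [SimpleGraph.Subgraph.deleteVerts_adj]
  constructor
  · rintro ⟨_, h1, _, h2, h⟩; exact ⟨h, h1, h2⟩
  · rintro ⟨h, h1, h2⟩; exact ⟨K.edge_vert h, h1, K.edge_vert h.symm, h2, h⟩

theorem mem_del {K : Γ.Subgraph} {w p : V} : p ∈ (del K w).verts ↔ p ∈ K.verts ∧ p ≠ w := Iff.rfl

theorem del_le (K : Γ.Subgraph) (w : V) : del K w ≤ K := SimpleGraph.Subgraph.deleteVerts_le

/-- The deletion of a single edge. -/
abbrev delE (K : Γ.Subgraph) (x y : V) : Γ.Subgraph := K.deleteEdges {s(x, y)}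

theorem delE_adj {K : Γ.Subgraph} {x y p q : V} :
    (delE K x y).Adj p q ↔ K.Adj p q ∧ ¬ (p = x ∧ q = y ∨ p = y ∧ q = x) := by
  rw [SimpleGraph.Subgraph.deleteEdges_adj]; simp

theorem delE_le (K : Γ.Subgraph) (x y : V) : delE K x y ≤ K :=
  SimpleGraph.Subgraph.deleteEdges_le _

theorem singleton_mem_connAt {K : Γ.Subgraph} {u : V} (hu : u ∈ K.verts) :
    Γ.singletonSubgraph u ∈ connAt u K :=
  ⟨by simpa using hu, SimpleGraph.Subgraph.singletonSubgraph_connected, rfl⟩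

/-! ### Counting darts; non-cut vertices, spanning trees and non-bridges. -/

section Finite

variable [Finite V]

theorem ncard_connIn_mono {K L : Γ.Subgraph} (h : K ≤ L) : (connIn K).ncard ≤ (connIn L).ncard :=
  Set.ncard_le_ncard (fun _ hS => ⟨hS.1.trans h, hS.2⟩) (Set.toFinite _)

theorem ncard_add_le {α : Type*} [Finite α] {A B C : Set α} (hA : A ⊆ C) (hB : B ⊆ C)
    (h : Disjoint A B) : A.ncard + B.ncard ≤ C.ncard := by
  rw [← Set.ncard_union_eq h (Set.toFinite _) (Set.toFinite _)]
  exact Set.ncard_le_ncard (Set.union_subset hA hB) (Set.toFinite _)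

/-- A lower bound for the size of a set from the values that a function takes on it. -/
theorem card_le_ncard_of_values {α β : Type*} [Finite α] {D : Set α} (σ : α → β) (T : Finset β)
    (h : ∀ b ∈ T, ∃ s ∈ D, σ s = b) : T.card ≤ D.ncard := by
  rw [← Set.ncard_coe_finset T]
  refine le_trans (Set.ncard_le_ncard (t := σ '' D) ?_ (Set.toFinite _))
    (Set.ncard_image_le (Set.toFinite _))
  intro b hb
  exact h b hb

theorem ncard_del {K : Γ.Subgraph} {w : V} (hw : w ∈ K.verts) :
    (del K w).verts.ncard + 1 = K.verts.ncard := by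
  rw [SimpleGraph.Subgraph.deleteVerts_verts]
  exact Set.ncard_sdiff_singleton_add_one hw (Set.toFinite _)

theorem darts_del (K : Γ.Subgraph) (w : V) :
    (darts K).ncard = (darts (del K w)).ncard + 2 * (K.neighborSet w).ncard := by
  have h1 : (Prod.mk w '' K.neighborSet w).ncard = (K.neighborSet w).ncard :=
    Set.ncard_image_of_injective _ (Prod.mk_right_injective w)
  have h2 : ((fun x => (x, w)) '' K.neighborSet w).ncard = (K.neighborSet w).ncard :=
    Set.ncard_image_of_injective _ (Prod.mk_left_injective w)
  have h3 : darts K = darts (del K w) ∪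
      (Prod.mk w '' K.neighborSet w ∪ (fun x => (x, w)) '' K.neighborSet w) := by
    ext ⟨p, q⟩
    simp only [darts, Set.mem_ofPred_eq, Set.mem_union, Set.mem_image, Prod.mk.injEq, del_adj,
      SimpleGraph.Subgraph.mem_neighborSet]
    constructor
    · intro h
      by_cases hp : p = w
      · exact Or.inr (Or.inl ⟨q, hp ▸ h, hp.symm, rfl⟩)
      · by_cases hq : q = w
        · exact Or.inr (Or.inr ⟨p, hq ▸ h.symm, rfl, hq.symm⟩)
        · exact Or.inl ⟨h, hp, hq⟩
    · rintro (h | ⟨_, h, rfl, rfl⟩ | ⟨_, h, rfl, rfl⟩)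
      · exact h.1
      · exact h
      · exact h.symm
  rw [h3, Set.ncard_union_eq _ (Set.toFinite _) (Set.toFinite _),
    Set.ncard_union_eq _ (Set.toFinite _) (Set.toFinite _), h1, h2]
  · ring
  · rw [Set.disjoint_left]
    rintro _ ⟨x, hx, rfl⟩ ⟨y, hy, h⟩
    simp only [Prod.mk.injEq] at h
    exact (K.adj_sub hx).ne h.2
  · rw [Set.disjoint_left]
    rintro ⟨p, q⟩ h (⟨x, hx, h'⟩ | ⟨x, hx, h'⟩) <;>
    · simp only [Prod.mk.injEq] at h'
      have := del_adj.1 (show (del K w).Adj p q from h)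
      tauto

/-- Deleting vertices one at a time removes an even number of darts each time. The parity later
turns a strict inequality between dart counts into a whole extra edge. -/
theorem darts_even (K : Γ.Subgraph) : 2 ∣ (darts K).ncard := by
  induction hn : K.verts.ncard generalizing K with
  | zero =>
    have : darts K = ∅ := by
      ext ⟨p, q⟩
      simp only [darts, Set.mem_ofPred_eq, Set.mem_empty_iff_false, iff_false]
      intro h
      have := K.edge_vert h
      rw [(Set.ncard_eq_zero (Set.toFinite _)).1 hn] at this
      exact this
    simp [this]
  | succ k ih =>
    obtain ⟨w, hw⟩ : K.verts.Nonempty := Set.nonempty_of_ncard_ne_zero (by omega)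
    have := ih (del K w) (by have := ncard_del hw; omega)
    rw [darts_del K w]
    omega

theorem darts_delE {K : Γ.Subgraph} {x y : V} (h : K.Adj x y) :
    (darts (delE K x y)).ncard + 2 = (darts K).ncard := by
  have h1 : darts K = darts (delE K x y) ∪ {(x, y), (y, x)} := by
    ext ⟨p, q⟩
    simp only [darts, Set.mem_ofPred_eq, Set.mem_union, delE_adj, Set.mem_insert_iff,
      Set.mem_singleton_iff, Prod.mk.injEq]
    constructor
    · tauto
    · rintro (h' | ⟨rfl, rfl⟩ | ⟨rfl, rfl⟩)
      exacts [h'.1, h, h.symm]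
  have hne := (K.adj_sub h).ne
  rw [h1, Set.ncard_union_eq _ (Set.toFinite _) (Set.toFinite _), Set.ncard_pair]
  · simp [hne]
  · rw [Set.disjoint_left]
    rintro ⟨p, q⟩ h2 h3
    have := delE_adj.1 (show (delE K x y).Adj p q from h2)
    simp only [Set.mem_insert_iff, Set.mem_singleton_iff, Prod.mk.injEq] at h3
    tauto

theorem darts_mono {K L : Γ.Subgraph} (h : K ≤ L) : (darts K).ncard ≤ (darts L).ncard :=
  Set.ncard_le_ncard (fun _ hp => h.2 hp) (Set.toFinite _)

/-- A connected subgraph that misses a vertex of `K` can be enlarged by one vertex. -/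
theorem exists_grow {K S : Γ.Subgraph} (hK : K.Connected) (hS : S.Connected) (hle : S ≤ K)
    (hne : S.verts ≠ K.verts) : ∃ T ≤ K, T.Connected ∧ S ≤ T ∧
      T.verts.ncard = S.verts.ncard + 1 := by
  obtain ⟨r, hr⟩ := hS.nonempty
  have : ∃ x y, K.Adj x y ∧ x ∈ S.verts ∧ y ∉ S.verts := by
    by_contra! hcon
    exact hne (subset_antisymm hle.1 (subset_of_closed hK (hle.1 hr) hr hcon))
  obtain ⟨x, y, hxy, hx, hy⟩ := this
  have hA : ({x} : Set V) ⊆ Γ.neighborSet y := by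
    simpa using (K.adj_sub hxy).symm
  refine ⟨addStar S y {x} hA, addStar_le hle (K.edge_vert hxy.symm) (by simpa using hxy.symm),
    addStar_connected hS rfl hx, ⟨fun p hp => Or.inr (Or.inl hp), fun p q h => Or.inl h⟩, ?_⟩
  have : (addStar S y {x} hA).verts = insert y S.verts := by
    ext p
    rw [mem_addStar, Set.mem_insert_iff, Set.mem_singleton_iff]
    constructor
    · rintro (h | h | rfl) <;> tauto
    · tauto
  rw [this, Set.ncard_insert_of_notMem hy (Set.toFinite _)]

theorem exists_conn_of_ncard {K : Γ.Subgraph} (hK : K.Connected) {u : V} (hu : u ∈ K.verts) {k : ℕ}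
    (h1 : 1 ≤ k) (hk : k ≤ K.verts.ncard) : ∃ S ∈ connAt u K, S.verts.ncard = k := by
  induction k, h1 using Nat.le_induction with
  | base => exact ⟨_, singleton_mem_connAt hu, by simp⟩
  | succ k h1 ih =>
    obtain ⟨S, ⟨hle, hS, hSu⟩, hcard⟩ := ih (by omega)
    obtain ⟨T, hT, hTc, hST, hTn⟩ := exists_grow hK hS hle (by rintro h; rw [h] at hcard; omega)
    exact ⟨T, ⟨hT, hTc, hST.1 hSu⟩, by omega⟩

/-- Every connected graph has a non-cut vertex different from a given vertex. -/
theorem exists_noncut {K : Γ.Subgraph} (hK : K.Connected) {u : V} (hu : u ∈ K.verts)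
    (h2 : 2 ≤ K.verts.ncard) : ∃ w ∈ K.verts, w ≠ u ∧ (del K w).Connected := by
  -- Grow a connected subgraph from `u` until a single vertex is missing; that vertex is not a cut
  -- vertex.
  obtain ⟨S, ⟨hle, hS, hSu⟩, hcard⟩ :=
    exists_conn_of_ncard hK hu (k := K.verts.ncard - 1) (by omega) (by omega)
  obtain ⟨w, hw⟩ : ∃ w, K.verts \ S.verts = {w} := by
    rw [← Set.ncard_eq_one]
    have := Set.ncard_sdiff_add_ncard_of_subset hle.1 (Set.toFinite _)
    omega
  have hwK : w ∈ K.verts \ S.verts := by rw [hw]; rfl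
  have hverts : (del K w).verts = S.verts := by
    ext p
    rw [mem_del]
    constructor
    · rintro ⟨hp, hpw⟩
      by_contra hps
      exact hpw (by have : p ∈ K.verts \ S.verts := ⟨hp, hps⟩
                    rw [hw] at this; exact this)
    · intro hp
      exact ⟨hle.1 hp, by rintro rfl; exact hwK.2 hp⟩
  refine ⟨w, hwK.1, by rintro rfl; exact hwK.2 hSu, ?_⟩
  refine SimpleGraph.Subgraph.Connected.mono ⟨hverts.ge, fun p q h => ?_⟩ hverts.symm hS
  rw [del_adj]
  exact ⟨hle.2 h, by rintro rfl; exact hwK.2 (S.edge_vert h),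
    by rintro rfl; exact hwK.2 (S.edge_vert h.symm)⟩

/-- Remove a non-cut vertex, take a tree of the rest and hang the vertex back on by one edge. Being
a tree is recorded only as connected with n - 1 edges, that is, 2n - 2 darts. -/
theorem exists_spanning_tree {K : Γ.Subgraph} (hK : K.Connected) :
    ∃ T ≤ K, T.Connected ∧ T.verts = K.verts ∧ (darts T).ncard + 2 = 2 * K.verts.ncard := by
  induction hn : K.verts.ncard generalizing K with
  | zero =>
    have := hK.nonempty
    rw [(Set.ncard_eq_zero (Set.toFinite _)).1 hn] at this
    simp at this
  | succ k ih =>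
    obtain ⟨u, hu⟩ := hK.nonempty
    rcases Nat.eq_zero_or_pos k with rfl | hk
    · refine ⟨_, (singleton_mem_connAt hu).1, (singleton_mem_connAt hu).2.1, ?_, ?_⟩
      · obtain ⟨a, ha⟩ := Set.ncard_eq_one.1 hn
        rw [ha] at hu ⊢
        obtain rfl := hu
        rfl
      · have : darts (Γ.singletonSubgraph u) = ∅ := by
          ext p; simp [darts]
        simp [this]
    obtain ⟨w, hw, hwu, hc⟩ := exists_noncut hK hu (by omega)
    obtain ⟨T, hT, hTc, hTv, hTd⟩ := ih hc (by have := ncard_del hw; omega)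
    obtain ⟨x, hx⟩ := exists_adj_of_connected hK hw hu hwu
    have hA : ({x} : Set V) ⊆ Γ.neighborSet w := by simpa using K.adj_sub hx
    have hxT : x ∈ T.verts := by
      rw [hTv, mem_del]
      exact ⟨K.edge_vert hx.symm, (K.adj_sub hx).ne'⟩
    have hwT : w ∉ T.verts := by rw [hTv, mem_del]; tauto
    refine ⟨addStar T w {x} hA, addStar_le (hT.trans (del_le _ _)) hw (by simpa using hx),
      addStar_connected hTc rfl hxT, ?_, ?_⟩
    · ext p
      rw [mem_addStar, hTv, mem_del, Set.mem_singleton_iff]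
      constructor
      · rintro (rfl | h | rfl)
        exacts [hw, h.1, K.edge_vert hx.symm]
      · tauto
    · have h1 : del (addStar T w {x} hA) w = T := by
        ext p q
        · rw [mem_del, mem_addStar, Set.mem_singleton_iff]
          constructor
          · rintro ⟨h | h | rfl, h'⟩
            exacts [absurd h h', h, hxT]
          · intro h
            exact ⟨by tauto, by rintro rfl; exact hwT h⟩
        · rw [del_adj, addStar_adj]
          constructor
          · tauto
          · intro h
            exact ⟨by tauto, by rintro rfl; exact hwT (T.edge_vert h),
              by rintro rfl; exact hwT (T.edge_vert h.symm)⟩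
      have h2 : (addStar T w {x} hA).neighborSet w = {x} := by
        ext p
        rw [SimpleGraph.Subgraph.mem_neighborSet, addStar_adj]
        constructor
        · rintro (h | h | h)
          · exact absurd (T.edge_vert h) hwT
          · exact h.2
          · exact absurd h.2 (by simpa using (K.adj_sub hx).ne)
        · tauto
      have := darts_del (addStar T w {x} hA) w
      rw [h1, h2, Set.ncard_singleton] at this
      omega

theorem le_darts_of_connected {K : Γ.Subgraph} (hK : K.Connected) :
    2 * K.verts.ncard ≤ (darts K).ncard + 2 := by
  obtain ⟨T, hT, _, _, h⟩ := exists_spanning_tree hK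
  have := darts_mono hT
  omega

/-- Any edge outside a spanning tree will do. -/
theorem exists_nonbridge {K : Γ.Subgraph} (hK : K.Connected)
    (h : 2 * K.verts.ncard ≤ (darts K).ncard) : ∃ x y, K.Adj x y ∧ (delE K x y).Connected := by
  obtain ⟨T, hT, hTc, hTv, hTd⟩ := exists_spanning_tree hK
  obtain ⟨⟨x, y⟩, hxy, hxyT⟩ := Set.exists_mem_notMem_of_ncard_lt_ncard
    (s := darts T) (t := darts K) (by omega) (Set.toFinite _)
  refine ⟨x, y, hxy, SimpleGraph.Subgraph.Connected.mono ⟨hTv.le, fun p q hpq => ?_⟩ hTv hTc⟩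
  rw [delE_adj]
  refine ⟨hT.2 hpq, ?_⟩
  rintro (⟨rfl, rfl⟩ | ⟨rfl, rfl⟩)
  · exact hxyT hpq
  · exact hxyT hpq.symm

theorem ncard_le_sq_of_darts (K : Γ.Subgraph) :
    (darts K).ncard + K.verts.ncard ≤ K.verts.ncard * K.verts.ncard := by
  have h1 : (darts K ∪ (fun x => (x, x)) '' K.verts).ncard ≤ (K.verts ×ˢ K.verts).ncard := by
    refine Set.ncard_le_ncard ?_ (Set.toFinite _)
    rintro ⟨p, q⟩ (h | ⟨x, hx, h⟩)
    · exact ⟨K.edge_vert h, K.edge_vert (K.symm.symm _ _ h)⟩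
    · simp only [Prod.mk.injEq] at h
      obtain ⟨rfl, rfl⟩ := h
      exact ⟨hx, hx⟩
  rw [Set.ncard_prod, Set.ncard_union_eq _ (Set.toFinite _) (Set.toFinite _),
    Set.ncard_image_of_injective _ (fun x y h => (Prod.mk.inj h).1)] at h1
  · exact h1
  · rw [Set.disjoint_left]
    rintro _ h ⟨x, hx, rfl⟩
    exact (K.adj_sub h).ne rfl

end Finite

end CoreIndex

/-! ### Lower bounds for the connected subgraphs through a vertex. -/

namespace CoreIndex

variable {V : Type*} {Γ : SimpleGraph V}

section Finite

variable [Finite V]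

theorem connAt_del_add_le {K : Γ.Subgraph} {u w : V} :
    (connAt u (del K w)).ncard + {S ∈ connAt u K | w ∈ S.verts}.ncard ≤ (connAt u K).ncard := by
  refine ncard_add_le (fun S hS => ⟨hS.1.trans (del_le _ _), hS.2⟩) (fun S hS => hS.1) ?_
  rw [Set.disjoint_left]
  intro S hS hS'
  exact (mem_del.1 (hS.1.1 hS'.2)).2 rfl

theorem connIn_del_add_le {K : Γ.Subgraph} {w : V} :
    (connIn (del K w)).ncard + (connAt w K).ncard ≤ (connIn K).ncard := by
  refine ncard_add_le (fun S hS => ⟨hS.1.trans (del_le _ _), hS.2⟩) (connAt_subset _ _) ?_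
  rw [Set.disjoint_left]
  intro S hS hS'
  exact (mem_del.1 (hS.1.1 hS'.2.2)).2 rfl

theorem one_le_ncard_connAt_mem {K : Γ.Subgraph} (hK : K.Connected) {u w : V} (hu : u ∈ K.verts)
    (hw : w ∈ K.verts) : 1 ≤ {S ∈ connAt u K | w ∈ S.verts}.ncard := by
  rw [Nat.one_le_iff_ne_zero, Ne, Set.ncard_eq_zero (Set.toFinite _)]
  exact Set.Nonempty.ne_empty ⟨K, ⟨le_rfl, hK, hu⟩, hw⟩

/-- In a connected graph every vertex lies in at least as many connected subgraphs as there are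
vertices. -/
theorem ncard_verts_le_connAt {K : Γ.Subgraph} (hK : K.Connected) {u : V} (hu : u ∈ K.verts) :
    K.verts.ncard ≤ (connAt u K).ncard := by
  have h : ∀ k ∈ Finset.Icc 1 K.verts.ncard, ∃ S ∈ connAt u K, S.verts.ncard = k := by
    intro k hk
    rw [Finset.mem_Icc] at hk
    exact exists_conn_of_ncard hK hu hk.1 hk.2
  simpa using card_le_ncard_of_values _ _ h

/-- Connected subgraphs through `w` that are stars at `w` glued to one of two given connected
subgraphs that avoid `w` and are distinguished by an edge. -/
theorem card_le_of_stars {K : Γ.Subgraph} {u w : V} (hw : w ∈ K.verts) {R : Bool → Γ.Subgraph}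
    (hR : ∀ b, R b ∈ connAt u (del K w)) {z t : V} (hz : ∀ b, (R b).Adj z t ↔ b = true) {k : ℕ}
    {f : Fin k → V} (hf : Function.Injective f) (hfK : ∀ i, K.Adj w (f i))
    (T : Finset (Finset (Fin k) × Bool)) (hT : ∀ p ∈ T, ∃ i ∈ p.1, f i ∈ (R p.2).verts) :
    T.card ≤ {S ∈ connAt u K | w ∈ S.verts}.ncard := by
  classical
  -- The code of a subgraph records which edges `w f(i)` it has and whether it has `zt`. Gluing the
  -- star `A` to `R b` realises the code `(A, b)`, because neither piece disturbs the other's bits.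
  refine card_le_ncard_of_values
    (fun S => (Finset.univ.filter fun i => S.Adj w (f i), decide (S.Adj z t))) T ?_
  rintro ⟨A, b⟩ hAb
  obtain ⟨i, hi, hiR⟩ := hT _ hAb
  have hAK : (f '' (A : Set (Fin k))) ⊆ K.neighborSet w := by
    rintro _ ⟨j, _, rfl⟩; exact hfK j
  have hAΓ : (f '' (A : Set (Fin k))) ⊆ Γ.neighborSet w :=
    hAK.trans (K.neighborSet_subset w)
  have hwR : w ∉ (R b).verts := fun h => (mem_del.1 ((hR b).1.1 h)).2 rfl
  have hzt : z ≠ w ∧ t ≠ w :=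
    (del_adj.1 ((hR true).1.2 ((hz true).2 rfl))).2
  refine ⟨addStar (R b) w (f '' (A : Set (Fin k))) hAΓ,
    ⟨⟨addStar_le ((hR b).1.trans (del_le _ _)) hw hAK,
      addStar_connected (hR b).2.1 ⟨i, hi, rfl⟩ hiR, Or.inr (Or.inl (hR b).2.2)⟩, Or.inl rfl⟩, ?_⟩
  rw [Prod.mk.injEq]
  constructor
  · ext j
    simp only [Finset.mem_filter, Finset.mem_univ, true_and, addStar_adj]
    constructor
    · rintro (h | h | ⟨h, _⟩)
      · exact absurd ((R b).edge_vert h) hwR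
      · simpa [hf.mem_set_image] using h
      · exact absurd h (K.adj_sub (hfK j)).ne'
    · intro h
      exact Or.inr (Or.inl (Set.mem_image_of_mem f h))
  · have : (addStar (R b) w (f '' (A : Set (Fin k))) hAΓ).Adj z t ↔ b = true := by
      rw [addStar_adj, ← hz b]
      tauto
    cases b <;> simpa using this

theorem exists_smaller {R : Γ.Subgraph} (hR : R.Connected) {u : V} (hu : u ∈ R.verts)
    (h2 : 2 ≤ R.verts.ncard) : ∃ z t, R.Adj z t ∧ (del R z) ∈ connAt u R := by
  obtain ⟨z, hz, hzu, hc⟩ := exists_noncut hR hu h2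
  obtain ⟨t, ht⟩ := exists_adj_of_connected hR hz hu hzu
  exact ⟨z, t, ht, del_le _ _, hc, hu, hzu.symm⟩

theorem three_le_of_darts {K : Γ.Subgraph} (hK : K.Connected)
    (h : 2 * K.verts.ncard ≤ (darts K).ncard) : 3 ≤ K.verts.ncard := by
  have h1 := ncard_le_sq_of_darts K
  have h2 : 0 < K.verts.ncard := (Set.ncard_pos (Set.toFinite _)).2 hK.nonempty
  by_contra hlt
  interval_cases K.verts.ncard <;> omega

/-- Glue stars at `w` to K - w, or to K - w - z for a non-cut vertex `z` of K - w. With neighbours x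
≠ z and y, the first base allows all 3 nonempty stars and the second at least the 2 containing x, so
3 + 2 = 5. -/
theorem five_le_of_two_neighbors {K : Γ.Subgraph} {u w : V} (hw : w ∈ K.verts) (hwu : w ≠ u)
    (hu : u ∈ K.verts) (hc : (del K w).Connected) (hn : 3 ≤ K.verts.ncard)
    (hd : 2 ≤ (K.neighborSet w).ncard) : 5 ≤ {S ∈ connAt u K | w ∈ S.verts}.ncard := by
  have huR : u ∈ (del K w).verts := ⟨hu, hwu.symm⟩
  obtain ⟨z, t, hzt, hR2⟩ := exists_smaller hc huR (by have := ncard_del hw; omega)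
  obtain ⟨x, hx, hxz⟩ := Set.exists_ne_of_one_lt_ncard (s := K.neighborSet w) (by omega) z
  obtain ⟨y, hy, hyx⟩ := Set.exists_ne_of_one_lt_ncard (s := K.neighborSet w) (by omega) x
  have hmem : ∀ p ∈ K.neighborSet w, p ∈ (del K w).verts := fun p hp =>
    ⟨K.edge_vert (K.symm.symm _ _ hp), (K.adj_sub hp).ne'⟩
  refine le_trans (le_of_eq ?_) (card_le_of_stars hw (R := fun b => if b then del K w else
    del (del K w) z) (z := z) (t := t) ?_ ?_ (f := ![x, y]) ?_ ?_
    (Finset.univ.filter fun p => if p.2 then p.1.Nonempty else 0 ∈ p.1) ?_)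
  · decide
  · rintro (_ | _)
    · exact hR2
    · exact ⟨le_rfl, hc, huR⟩
  · rintro (_ | _)
    · simp
    · simpa using hzt
  · intro i j
    fin_cases i <;> fin_cases j <;> simp [hyx, hyx.symm]
  · intro i
    fin_cases i
    exacts [hx, hy]
  · rintro ⟨A, (_ | _)⟩ hp
    · exact ⟨0, by simpa using hp, hmem x hx, hxz⟩
    · obtain ⟨i, hi⟩ : A.Nonempty := by simpa using hp
      refine ⟨i, hi, hmem _ ?_⟩
      fin_cases i
      exacts [hx, hy]

/-- Here K - w has a non-bridge, so the second base can keep every vertex and drop only that edge.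
Both bases then accept all three nonempty stars. -/
theorem six_le_of_two_neighbors {K : Γ.Subgraph} {u w : V} (hw : w ∈ K.verts) (hwu : w ≠ u)
    (hu : u ∈ K.verts) (hc : (del K w).Connected)
    (hcyc : 2 * (del K w).verts.ncard ≤ (darts (del K w)).ncard)
    (hd : 2 ≤ (K.neighborSet w).ncard) : 6 ≤ {S ∈ connAt u K | w ∈ S.verts}.ncard := by
  have huR : u ∈ (del K w).verts := ⟨hu, hwu.symm⟩
  obtain ⟨z, t, hzt, hR2⟩ := exists_nonbridge hc hcyc
  obtain ⟨x, y, hx, hy, hyx⟩ := (Set.one_lt_ncard_iff (Set.toFinite (K.neighborSet w))).1 hd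
  have hmem : ∀ p ∈ K.neighborSet w, p ∈ (del K w).verts := fun p hp =>
    ⟨K.edge_vert (K.symm.symm _ _ hp), (K.adj_sub hp).ne'⟩
  refine le_trans (le_of_eq ?_) (card_le_of_stars hw (R := fun b => if b then del K w else
    delE (del K w) z t) (z := z) (t := t) ?_ ?_ (f := ![x, y]) ?_ ?_
    (Finset.univ.filter fun p => p.1.Nonempty) ?_)
  · decide
  · rintro (_ | _)
    · exact ⟨delE_le _ _ _, hR2, huR⟩
    · exact ⟨le_rfl, hc, huR⟩
  · rintro (_ | _)
    · simp
    · simpa using hzt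
  · intro i j
    fin_cases i <;> fin_cases j <;> simp [hyx, hyx.symm]
  · intro i
    fin_cases i
    exacts [hx, hy]
  · rintro ⟨A, b⟩ hp
    obtain ⟨i, hi⟩ : A.Nonempty := by simpa using hp
    refine ⟨i, hi, ?_⟩
    have : (![x, y] : Fin 2 → V) i ∈ (del K w).verts := by
      refine hmem _ ?_
      fin_cases i
      exacts [hx, hy]
    cases b <;> exact this

theorem ten_le_of_three_neighbors {K : Γ.Subgraph} {u w : V} (hw : w ∈ K.verts) (hwu : w ≠ u)
    (hu : u ∈ K.verts) (hc : (del K w).Connected) (hn : 3 ≤ K.verts.ncard)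
    (hd : 3 ≤ (K.neighborSet w).ncard) : 10 ≤ {S ∈ connAt u K | w ∈ S.verts}.ncard := by
  have huR : u ∈ (del K w).verts := ⟨hu, hwu.symm⟩
  obtain ⟨z, t, hzt, hR2⟩ := exists_smaller hc huR (by have := ncard_del hw; omega)
  obtain ⟨x, hx, hxz⟩ := Set.exists_ne_of_one_lt_ncard (s := K.neighborSet w) (by omega) z
  have h1 := Set.ncard_sdiff_singleton_add_one hx (Set.toFinite _)
  obtain ⟨y, hy, hyz⟩ := Set.exists_ne_of_one_lt_ncard (s := K.neighborSet w \ {x}) (by omega) z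
  obtain ⟨s, hs, hsy⟩ := Set.exists_ne_of_one_lt_ncard (s := K.neighborSet w \ {x}) (by omega) y
  have hyx : y ≠ x := hy.2
  have hsx : s ≠ x := hs.2
  have hmem : ∀ p ∈ K.neighborSet w, p ∈ (del K w).verts := fun p hp =>
    ⟨K.edge_vert (K.symm.symm _ _ hp), (K.adj_sub hp).ne'⟩
  refine le_trans ?_ (card_le_of_stars hw (R := fun b => if b then del K w else
    del (del K w) z) (z := z) (t := t) ?_ ?_ (f := ![x, y, s]) ?_ ?_
    (Finset.univ.filter fun p => if p.2 then p.1.Nonempty else 0 ∈ p.1 ∨ 1 ∈ p.1) ?_)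
  -- The admissible pairs number 7 + 6 = 13: all nonempty stars on the full base, those meeting {x,
  -- y} on the smaller one. Ten suffice below.
  · decide
  · rintro (_ | _)
    · exact hR2
    · exact ⟨le_rfl, hc, huR⟩
  · rintro (_ | _)
    · simp
    · simpa using hzt
  · intro i j
    fin_cases i <;> fin_cases j <;> simp [hyx, hyx.symm, hsx, hsx.symm, hsy, hsy.symm]
  · intro i
    fin_cases i
    exacts [hx, hy.1, hs.1]
  · rintro ⟨A, (_ | _)⟩ hp
    · have hp' : 0 ∈ A ∨ 1 ∈ A := by simpa using hp
      rcases hp' with h | h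
      · exact ⟨0, h, hmem x hx, hxz⟩
      · exact ⟨1, h, hmem y hy.1, hyz⟩
    · obtain ⟨i, hi⟩ : A.Nonempty := by simpa using hp
      refine ⟨i, hi, hmem _ ?_⟩
      fin_cases i
      exacts [hx, hy.1, hs.1]

theorem one_le_ncard_neighborSet {K : Γ.Subgraph} (hK : K.Connected) {u w : V} (hu : u ∈ K.verts)
    (hw : w ∈ K.verts) (hwu : w ≠ u) : 1 ≤ (K.neighborSet w).ncard :=
  (Set.ncard_pos (Set.toFinite _)).2 (exists_adj_of_connected hK hw hu hwu)

/-- Delete a non-cut vertex w ≠ u. If w is a leaf, the rest still has as many edges as vertices and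
K itself is one more subgraph; otherwise (n - 1) + 5 = n + 4. -/
theorem add_four_le_connAt {K : Γ.Subgraph} (hK : K.Connected) {u : V} (hu : u ∈ K.verts)
    (h : 2 * K.verts.ncard ≤ (darts K).ncard) : K.verts.ncard + 4 ≤ (connAt u K).ncard := by
  induction hn : K.verts.ncard generalizing K with
  | zero => have := three_le_of_darts hK h; omega
  | succ k ih =>
    have h3 := three_le_of_darts hK h
    obtain ⟨w, hw, hwu, hc⟩ := exists_noncut hK hu (by omega)
    have huR : u ∈ (del K w).verts := ⟨hu, hwu.symm⟩
    have h1 := one_le_ncard_neighborSet hK hu hw hwu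
    have h4 := ncard_del hw
    have h5 := darts_del K w
    have h6 := connAt_del_add_le (K := K) (u := u) (w := w)
    have h7 := one_le_ncard_connAt_mem hK hu hw
    rcases h1.eq_or_lt with h1 | h1
    · have := ih hc huR (by omega) (by omega)
      omega
    · have := five_le_of_two_neighbors hw hwu hu hc h3 h1
      have := ncard_verts_le_connAt hc huR
      omega

/-- The same deletion, by the degree of w. A leaf is handled by induction, degree two leaves a graph
with a cycle and gives (n - 1 + 4) + 6, and degree at least three gives (n - 1) + 10. -/
theorem add_nine_le_connAt {K : Γ.Subgraph} (hK : K.Connected) {u : V} (hu : u ∈ K.verts)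
    (h : 2 * K.verts.ncard + 2 ≤ (darts K).ncard) : K.verts.ncard + 9 ≤ (connAt u K).ncard := by
  induction hn : K.verts.ncard generalizing K with
  | zero => have := three_le_of_darts hK (by omega); omega
  | succ k ih =>
    have h3 := three_le_of_darts hK (by omega)
    obtain ⟨w, hw, hwu, hc⟩ := exists_noncut hK hu (by omega)
    have huR : u ∈ (del K w).verts := ⟨hu, hwu.symm⟩
    have h1 := one_le_ncard_neighborSet hK hu hw hwu
    have h4 := ncard_del hw
    have h5 := darts_del K w
    have h6 := connAt_del_add_le (K := K) (u := u) (w := w)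
    have h7 := one_le_ncard_connAt_mem hK hu hw
    rcases h1.eq_or_lt with h1 | h1
    · have := ih hc huR (by omega) (by omega)
      omega
    rcases (show 2 ≤ _ from h1).eq_or_lt with h2 | h2
    · have := six_le_of_two_neighbors hw hwu hu hc (by omega) h1
      have := add_four_le_connAt hc huR (by omega)
      omega
    · have := ten_le_of_three_neighbors hw hwu hu hc h3 h2
      have := ncard_verts_le_connAt hc huR
      omega

theorem exists_noncut' {K : Γ.Subgraph} (hK : K.Connected) (h2 : 2 ≤ K.verts.ncard) :
    ∃ w ∈ K.verts, (del K w).Connected := by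
  obtain ⟨u, hu⟩ := hK.nonempty
  obtain ⟨w, hw, _, hc⟩ := exists_noncut hK hu h2
  exact ⟨w, hw, hc⟩

/-- A connected graph on `n` vertices has at least `n (n + 1) / 2` connected subgraphs. -/
theorem mul_succ_le_connIn {K : Γ.Subgraph} (hK : K.Connected) :
    K.verts.ncard * (K.verts.ncard + 1) ≤ 2 * (connIn K).ncard := by
  induction hn : K.verts.ncard generalizing K with
  | zero => simp
  | succ k ih =>
    obtain ⟨u, hu⟩ := hK.nonempty
    have h1 := ncard_verts_le_connAt hK hu
    rcases Nat.eq_zero_or_pos k with rfl | hk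
    · have := Set.ncard_le_ncard (connAt_subset u K) (Set.toFinite _)
      omega
    obtain ⟨w, hw, hc⟩ := exists_noncut' hK (by omega)
    have h2 := ncard_verts_le_connAt hK hw
    have h3 := ih hc (by have := ncard_del hw; omega)
    have h4 := connIn_del_add_le (K := K) (w := w)
    nlinarith

theorem ten_le_connIn {K : Γ.Subgraph} (hK : K.Connected) (hn : K.verts.ncard = 3)
    (h : 6 ≤ (darts K).ncard) : 10 ≤ (connIn K).ncard := by
  obtain ⟨w, hw, hc⟩ := exists_noncut' hK (by omega)
  have h1 := add_four_le_connAt hK hw (by omega)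
  have h2 := mul_succ_le_connIn hc
  rw [show (del K w).verts.ncard = 2 by have := ncard_del hw; omega] at h2
  have h3 := connIn_del_add_le (K := K) (w := w)
  omega

theorem seventeen_le_connIn {K : Γ.Subgraph} (hK : K.Connected) (hn : K.verts.ncard = 4)
    (h : 10 ≤ (darts K).ncard) : 17 ≤ (connIn K).ncard := by
  obtain ⟨w, hw, hc⟩ := exists_noncut' hK (by omega)
  have h1 := add_nine_le_connAt hK hw (by omega)
  have h2 := mul_succ_le_connIn hc
  rw [show (del K w).verts.ncard = 3 by have := ncard_del hw; omega] at h2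
  have h3 := connIn_del_add_le (K := K) (w := w)
  omega

end Finite

end CoreIndex

/-! ### Contraction of an edge. -/

namespace CoreIndex

variable {V : Type*}

section Image

variable (φ : V → V)

/-- The simple graph obtained from `K` by identifying vertices along `φ`. -/
def image (K : (⊤ : SimpleGraph V).Subgraph) : (⊤ : SimpleGraph V).Subgraph where
  verts := φ '' K.verts
  Adj x y := x ≠ y ∧ ∃ p q, φ p = x ∧ φ q = y ∧ K.Adj p q
  adj_sub := fun h => h.1
  edge_vert := by
    rintro x y ⟨_, p, q, rfl, _, h⟩
    exact ⟨p, K.edge_vert h, rfl⟩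
  symm := ⟨by
    rintro x y ⟨h1, p, q, h2, h3, h4⟩
    exact ⟨h1.symm, q, p, h3, h2, h4.symm⟩⟩

/-- The subgraph of `K` lying over a subgraph of `image φ K`. -/
def lift (K S : (⊤ : SimpleGraph V).Subgraph) : (⊤ : SimpleGraph V).Subgraph where
  verts := {x | x ∈ K.verts ∧ φ x ∈ S.verts}
  Adj x y := K.Adj x y ∧ (S.Adj (φ x) (φ y) ∨ (φ x = φ y ∧ φ x ∈ S.verts))
  adj_sub := fun h => K.adj_sub h.1
  edge_vert := fun h => ⟨K.edge_vert h.1, h.2.elim S.edge_vert And.right⟩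
  symm := ⟨by
    rintro x y ⟨h, h' | ⟨h1, h2⟩⟩
    · exact ⟨h.symm, Or.inl h'.symm⟩
    · exact ⟨h.symm, Or.inr ⟨h1.symm, h1 ▸ h2⟩⟩⟩

variable {φ} {K S : (⊤ : SimpleGraph V).Subgraph}

theorem mem_image {x : V} : x ∈ (image φ K).verts ↔ ∃ p ∈ K.verts, φ p = x := Iff.rfl

theorem image_adj {x y : V} :
    (image φ K).Adj x y ↔ x ≠ y ∧ ∃ p q, φ p = x ∧ φ q = y ∧ K.Adj p q := Iff.rfl

theorem image_connected (hK : K.Connected) : (image φ K).Connected := by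
  obtain ⟨r, hr⟩ := hK.nonempty
  refine connected_of_root (r := φ r) ⟨r, hr, rfl⟩ ?_
  rintro _ ⟨x, hx, rfl⟩
  have := reach hK hr hx
  clear hx
  induction this with
  | refl => exact .refl
  | @tail p q _ hpq ih =>
    by_cases h : φ p = φ q
    · exact h ▸ ih
    · exact ih.tail ⟨h, p, q, rfl, rfl, hpq⟩

theorem lift_le : lift φ K S ≤ K := ⟨fun _ h => h.1, fun _ _ h => h.1⟩

/-- Each fibre is a single vertex or an adjacent pair, so a walk below lifts edge by edge, moving
inside fibres where necessary. -/
theorem lift_connected (hφ : ∀ x ∈ K.verts, ∀ y ∈ K.verts, φ x = φ y → x = y ∨ K.Adj x y)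
    (hS : S.Connected) (hle : S ≤ image φ K) : (lift φ K S).Connected := by
  obtain ⟨_, hr'⟩ := hS.nonempty
  obtain ⟨r, hr, rfl⟩ := hle.1 hr'
  have fibre : ∀ x y, x ∈ K.verts → y ∈ K.verts → φ x = φ y → φ x ∈ S.verts →
      ReflTransGen (lift φ K S).Adj x y := by
    intro x y hx hy hxy hxS
    rcases hφ x hx y hy hxy with rfl | h
    · exact .refl
    · exact .single ⟨h, Or.inr ⟨hxy, hxS⟩⟩
  have key : ∀ s, ReflTransGen S.Adj (φ r) s → ∀ x ∈ K.verts, φ x = s →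
      ReflTransGen (lift φ K S).Adj r x := by
    intro s hs
    induction hs with
    | refl => exact fun x hx hxr => fibre r x hr hx hxr.symm hr'
    | tail _ hst ih =>
      intro x hx hxt
      obtain ⟨_, p, q, rfl, rfl, hpq⟩ := hle.2 hst
      have h1 := ih p (K.edge_vert hpq) rfl
      have h2 : (lift φ K S).Adj p q := ⟨hpq, Or.inl hst⟩
      exact (h1.tail h2).trans
        (fibre q x (K.edge_vert hpq.symm) hx hxt.symm (S.edge_vert hst.symm))
  exact connected_of_root (r := r) ⟨hr, hr'⟩ fun x hx => key _ (reach hS hr' hx.2) x hx.1 rfl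

/-- Vertices and edges of `image φ K` have preimages in `K`, so the lift reflects the order; this is
what makes lifting injective. -/
theorem le_of_lift_le {T : (⊤ : SimpleGraph V).Subgraph} (hS : S ≤ image φ K)
    (h : lift φ K S ≤ lift φ K T) : S ≤ T := by
  constructor
  · intro s hs
    obtain ⟨p, hp, rfl⟩ := hS.1 hs
    exact (h.1 ⟨hp, hs⟩ : p ∈ (lift φ K T).verts).2
  · intro s t hst
    obtain ⟨hne, p, q, rfl, rfl, hpq⟩ := hS.2 hst
    rcases (h.2 (v := p) (w := q) ⟨hpq, Or.inl hst⟩).2 with h | h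
    · exact h
    · exact absurd h.1 hne

end Image

/-- The map that sends `v` to `a` and fixes all other vertices. -/
noncomputable def collapse (v a : V) (x : V) : V := by
  classical exact if x = v then a else x

theorem collapse_self (v a : V) : collapse v a v = a := by simp [collapse]

theorem collapse_of_ne {v a x : V} (h : x ≠ v) : collapse v a x = x := by simp [collapse, h]

theorem collapse_eq_iff {v a x y : V} : collapse v a x = collapse v a y ↔
    x = y ∨ (x = v ∧ y = a) ∨ (x = a ∧ y = v) := by
  by_cases hx : x = v <;> by_cases hy : y = v
  · simp [hx, hy]
  · subst hx
    rw [collapse_self, collapse_of_ne hy]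
    grind
  · subst hy
    rw [collapse_self, collapse_of_ne hx]
    grind
  · rw [collapse_of_ne hx, collapse_of_ne hy]
    grind

/-- The contraction of the edge `va`, where `a` represents the new vertex. -/
noncomputable abbrev contract (K : (⊤ : SimpleGraph V).Subgraph) (v a : V) :
    (⊤ : SimpleGraph V).Subgraph := image (collapse v a) K

variable {K : (⊤ : SimpleGraph V).Subgraph} {v a : V}

theorem contract_verts (h : K.Adj v a) : (contract K v a).verts = K.verts \ {v} := by
  ext x
  rw [mem_image]
  constructor
  · rintro ⟨p, hp, rfl⟩
    by_cases hpv : p = v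
    · subst hpv
      rw [collapse_self]
      exact ⟨K.edge_vert h.symm, (K.adj_sub h).ne'⟩
    · rw [collapse_of_ne hpv]
      exact ⟨hp, hpv⟩
  · rintro ⟨hx, hxv⟩
    exact ⟨x, hx, collapse_of_ne hxv⟩

section Finite

variable [Finite V]

theorem contract_ncard (h : K.Adj v a) : (contract K v a).verts.ncard + 1 = K.verts.ncard := by
  rw [contract_verts h]
  exact Set.ncard_sdiff_singleton_add_one (K.edge_vert h) (Set.toFinite _)

/-- Without a common neighbour of `v` and `a` no two edges merge, so exactly the edge `va`
disappears and the cyclomatic number is kept. -/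
theorem contract_darts (h : K.Adj v a) (hno : ∀ x, K.Adj v x → ¬ K.Adj a x) :
    (darts (contract K v a)).ncard + 2 = (darts K).ncard := by
  rw [← darts_delE h]
  have h1 : darts (contract K v a) =
      (fun p : V × V => (collapse v a p.1, collapse v a p.2)) '' darts (delE K v a) := by
    ext ⟨x, y⟩
    simp only [darts, Set.mem_ofPred_eq, Set.mem_image, Prod.mk.injEq, Prod.exists, image_adj,
      delE_adj]
    constructor
    · rintro ⟨hne, p, q, rfl, rfl, hpq⟩
      rw [Ne, collapse_eq_iff] at hne
      exact ⟨p, q, ⟨hpq, by tauto⟩, rfl, rfl⟩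
    · rintro ⟨p, q, ⟨hpq, hne⟩, rfl, rfl⟩
      refine ⟨?_, p, q, rfl, rfl, hpq⟩
      rw [Ne, collapse_eq_iff]
      have := (K.adj_sub hpq).ne
      tauto
  rw [h1, Set.InjOn.ncard_image]
  rintro ⟨p, q⟩ hpq ⟨p', q'⟩ hpq' heq
  simp only [Prod.mk.injEq, collapse_eq_iff] at heq ⊢
  obtain ⟨h2, h3⟩ := delE_adj.1 (show (delE K v a).Adj p q from hpq)
  obtain ⟨h4, h5⟩ := delE_adj.1 (show (delE K v a).Adj p' q' from hpq')
  have h6 := (K.adj_sub h2).ne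
  have h7 := (K.adj_sub h4).ne
  have h8 := h2.symm
  have h9 := h4.symm
  grind

/-- Contracting `va` loses at least the connected subgraphs that contain `v` or `a`
but not the edge `va`. -/
theorem contract_add_le (h : K.Adj v a) {P Q : (⊤ : SimpleGraph V).Subgraph} (hP : P ≤ K)
    (hQ : Q ≤ K) (hPe : ¬ P.Adj v a) (hQv : v ∉ Q.verts) :
    (connIn (contract K v a)).ncard + (connAt v P).ncard + (connAt a Q).ncard ≤
      (connIn K).ncard := by
  have hφ : ∀ x ∈ K.verts, ∀ y ∈ K.verts, collapse v a x = collapse v a y →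
      x = y ∨ K.Adj x y := by
    intro x _ y _ hxy
    rcases collapse_eq_iff.1 hxy with h' | ⟨rfl, rfl⟩ | ⟨rfl, rfl⟩
    exacts [Or.inl h', Or.inr h, Or.inr h.symm]
  have h1 : (connIn (contract K v a)).ncard =
      (lift (collapse v a) K '' connIn (contract K v a)).ncard := by
    rw [Set.InjOn.ncard_image]
    intro S hS T hT hST
    exact le_antisymm (le_of_lift_le hS.1 hST.le) (le_of_lift_le hT.1 hST.ge)
  -- A lift keeps fibres whole: meeting {v, a} forces it to contain both vertices and the edge
  -- between them.
  have h2 : ∀ S, (v ∈ S.verts ∨ a ∈ S.verts) → ¬ S.Adj v a →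
      S ∉ lift (collapse v a) K '' connIn (contract K v a) := by
    rintro _ h3 h4 ⟨S, hS, rfl⟩
    have hv := collapse_self v a
    have ha := collapse_of_ne (a := a) (K.adj_sub h).ne'
    have haS : a ∈ S.verts := by
      rcases h3 with h3 | h3
      · rw [← hv]; exact h3.2
      · rw [← ha]; exact h3.2
    exact h4 ⟨h, Or.inr ⟨by rw [hv, ha], by rw [hv]; exact haS⟩⟩
  rw [h1, add_assoc]
  have h3 : (connAt v P).ncard + (connAt a Q).ncard ≤ (connAt v P ∪ connAt a Q).ncard := by
    refine ncard_add_le Set.subset_union_left Set.subset_union_right ?_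
    rw [Set.disjoint_left]
    exact fun S hS hS' => hQv (hS'.1.1 hS.2.2)
  refine (Nat.add_le_add_left h3 _).trans (ncard_add_le ?_ ?_ ?_)
  · rintro _ ⟨S, hS, rfl⟩
    exact ⟨lift_le, lift_connected hφ hS.2 hS.1⟩
  · rintro S (hS | hS)
    · exact ⟨hS.1.trans hP, hS.2.1⟩
    · exact ⟨hS.1.trans hQ, hS.2.1⟩
  · rw [Set.disjoint_right]
    rintro S (hS | hS)
    · exact h2 S (Or.inl hS.2.2) fun h' => hPe (hS.1.2 h')
    · exact h2 S (Or.inr hS.2.2) fun h' => hQv (Q.edge_vert (hS.1.2 h'))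

end Finite

theorem delE_connected {b : V} (hc : (del K v).Connected) (hb : K.Adj v b) (hba : b ≠ a) :
    (delE K v a).Connected := by
  have hA : ({b} : Set V) ⊆ (⊤ : SimpleGraph V).neighborSet v := by simpa using K.adj_sub hb
  have hbv := (K.adj_sub hb).ne'
  refine SimpleGraph.Subgraph.Connected.mono (H := addStar (del K v) v {b} hA) ⟨?_, ?_⟩ ?_
    (addStar_connected hc rfl ⟨K.edge_vert hb.symm, hbv⟩)
  · rintro p (rfl | hp | rfl)
    exacts [K.edge_vert hb, hp.1, K.edge_vert hb.symm]
  · rintro p q (h | ⟨rfl, rfl⟩ | ⟨rfl, rfl⟩)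
    · rw [delE_adj]
      have := del_adj.1 h
      tauto
    · rw [delE_adj]
      exact ⟨hb, by tauto⟩
    · rw [delE_adj]
      exact ⟨hb.symm, by tauto⟩
  · ext p
    rw [mem_addStar, mem_del, Set.mem_singleton_iff]
    constructor
    · rintro (rfl | hp | rfl)
      exacts [K.edge_vert hb, hp.1, K.edge_vert hb.symm]
    · intro (hp : p ∈ K.verts)
      tauto

/-- After `va` is removed, `v` is a leaf at `b`, and no route between other vertices needs it. -/
theorem del_connected {b : V} (hc : (delE K v a).Connected) (hb : K.Adj v b)
    (hN : ∀ x, K.Adj v x → x = a ∨ x = b) : (del K v).Connected := by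
  have hbv := (K.adj_sub hb).ne'
  have hbK := K.edge_vert hb.symm
  refine connected_of_root (r := b) ⟨hbK, hbv⟩ fun x hx => ?_
  have key : ∀ y, ReflTransGen (delE K v a).Adj b y → y = v ∨ ReflTransGen (del K v).Adj b y := by
    intro y hy
    induction hy with
    | refl => exact Or.inr .refl
    | @tail y z _ hyz ih =>
      obtain ⟨h1, h2⟩ := delE_adj.1 hyz
      by_cases hz : z = v
      · exact Or.inl hz
      rcases ih with rfl | ih
      · rcases hN z h1 with rfl | rfl
        · tauto
        · exact Or.inr .refl
      · by_cases hy : y = v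
        · subst hy
          rcases hN z h1 with rfl | rfl
          · tauto
          · exact Or.inr .refl
        · exact Or.inr (ih.tail (del_adj.2 ⟨h1, hy, hz⟩))
  exact (key x (reach hc hbK hx.1)).resolve_left hx.2

/-! ### Bridges and their two sides. -/

/-- The vertices reachable from `r`, with all edges of `K` between them. -/
def comp (K : (⊤ : SimpleGraph V).Subgraph) (r : V) : (⊤ : SimpleGraph V).Subgraph :=
  K.induce {x | ReflTransGen K.Adj r x}

theorem mem_comp {r x : V} : x ∈ (comp K r).verts ↔ ReflTransGen K.Adj r x := Iff.rfl

theorem comp_adj {r x y : V} :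
    (comp K r).Adj x y ↔ ReflTransGen K.Adj r x ∧ K.Adj x y := by
  rw [comp, SimpleGraph.Subgraph.induce_adj]
  constructor
  · exact fun h => ⟨h.1, h.2.2⟩
  · exact fun h => ⟨h.1, h.1.tail h.2, h.2⟩

theorem comp_connected (r : V) : (comp K r).Connected := by
  refine connected_of_root (r := r) (mem_comp.2 .refl) fun x hx => ?_
  have hx : ReflTransGen K.Adj r x := hx
  induction hx with
  | refl => exact .refl
  | tail h1 h2 ih => exact (ih (mem_comp.2 h1)).tail (comp_adj.2 ⟨h1, h2⟩)

theorem comp_le {r : V} (hr : r ∈ K.verts) : comp K r ≤ K := by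
  refine ⟨fun x hx => ?_, fun x y h => (comp_adj.1 h).2⟩
  rcases (mem_comp.1 hx).cases_tail with rfl | ⟨y, _, h⟩
  · exact hr
  · exact K.edge_vert h.symm

/-- A bridge splits a connected graph into two connected parts. -/
theorem exists_sides [Finite V] (hK : K.Connected) (h : K.Adj v a)
    (hbr : ¬ (delE K v a).Connected) :
    ∃ A ≤ K, ∃ B ≤ K, A.Connected ∧ B.Connected ∧ v ∈ A.verts ∧ a ∈ B.verts ∧
      Disjoint A.verts B.verts ∧ A.verts.ncard + B.verts.ncard = K.verts.ncard ∧
      (darts A).ncard + (darts B).ncard + 2 = (darts K).ncard := by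
  have hv := K.edge_vert h
  have ha := K.edge_vert h.symm
  have hcover : ∀ x, ReflTransGen K.Adj v x →
      ReflTransGen (delE K v a).Adj v x ∨ ReflTransGen (delE K v a).Adj a x := by
    intro x hx
    induction hx with
    | refl => exact Or.inl .refl
    | @tail y z _ hyz ih =>
      by_cases he : y = v ∧ z = a ∨ y = a ∧ z = v
      · rcases he with ⟨_, rfl⟩ | ⟨_, rfl⟩
        · exact Or.inr .refl
        · exact Or.inl .refl
      · have hyz' := delE_adj.2 ⟨hyz, he⟩
        exact ih.imp (fun h => h.tail hyz') (fun h => h.tail hyz')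
  have hva : ¬ ReflTransGen (delE K v a).Adj v a := fun hva => by
    refine hbr (connected_of_root (r := v) hv fun x hx => ?_)
    rcases hcover x (reach hK hv hx) with h' | h'
    · exact h'
    · exact hva.trans h'
  have hdisj : ∀ x, ReflTransGen (delE K v a).Adj v x → ¬ ReflTransGen (delE K v a).Adj a x :=
    fun x h1 h2 => hva (h1.trans (reflTransGen_symm h2))
  have hle1 : comp (delE K v a) v ≤ delE K v a := comp_le hv
  have hle2 : comp (delE K v a) a ≤ delE K v a := comp_le ha
  have hd : Disjoint (comp (delE K v a) v).verts (comp (delE K v a) a).verts :=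
    Set.disjoint_left.2 hdisj
  refine ⟨comp (delE K v a) v, hle1.trans (delE_le _ _ _), comp (delE K v a) a,
    hle2.trans (delE_le _ _ _), comp_connected _, comp_connected _, mem_comp.2 .refl,
    mem_comp.2 .refl, hd, ?_, ?_⟩
  · rw [← Set.ncard_union_eq hd (Set.toFinite _) (Set.toFinite _)]
    congr 1
    refine subset_antisymm (Set.union_subset hle1.1 hle2.1) ?_
    exact fun x hx => hcover x (reach hK hv hx)
  · rw [← darts_delE h, ← Set.ncard_union_eq _ (Set.toFinite _) (Set.toFinite _)]
    · congr 2
      refine subset_antisymm (Set.union_subset (fun p hp => hle1.2 hp) fun p hp => hle2.2 hp) ?_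
      rintro ⟨p, q⟩ (hp : (delE K v a).Adj p q)
      exact (hcover p (reach hK hv (K.edge_vert (delE_adj.1 hp).1))).imp
        (fun h => comp_adj.2 ⟨h, hp⟩) (fun h => comp_adj.2 ⟨h, hp⟩)
    · rw [Set.disjoint_left]
      exact fun p h1 h2 => hdisj p.1 (comp_adj.1 h1).1 (comp_adj.1 h2).1

/-- The connected subgraphs on both sides of a bridge, and those through the bridge. -/
theorem bridge_le [Finite V] (h : K.Adj v a) {A B : (⊤ : SimpleGraph V).Subgraph} (hA : A ≤ K)
    (hB : B ≤ K) (hv : v ∈ A.verts) (ha : a ∈ B.verts) (hd : Disjoint A.verts B.verts) :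
    (connIn A).ncard + (connIn B).ncard + (connAt v A).ncard * (connAt a B).ncard ≤
      (connIn K).ncard := by
  have hva : (⊤ : SimpleGraph V).Adj v a := K.adj_sub h
  set f : (⊤ : SimpleGraph V).Subgraph × (⊤ : SimpleGraph V).Subgraph →
    (⊤ : SimpleGraph V).Subgraph := fun p => p.1 ⊔ (p.2 ⊔ SimpleGraph.subgraphOfAdj _ hva) with hf
  have hvB : v ∉ B.verts := Set.disjoint_left.1 hd hv
  have haA : a ∉ A.verts := Set.disjoint_right.1 hd ha
  have h1 : (connAt v A).ncard * (connAt a B).ncard = (f '' (connAt v A ×ˢ connAt a B)).ncard := by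
    rw [← Set.ncard_prod, Set.InjOn.ncard_image]
    -- The sides are disjoint, so both factors can be read off from the union; the only extra edge
    -- is the bridge itself.
    have key : ∀ S S' T T', S ∈ connAt v A → S' ∈ connAt v A → T ∈ connAt a B → T' ∈ connAt a B →
        f (S, T) ≤ f (S', T') → S ≤ S' ∧ T ≤ T' := by
      intro S S' T T' hS hS' hT hT' hle
      refine ⟨⟨fun x hx => ?_, fun x y hxy => ?_⟩, ⟨fun x hx => ?_, fun x y hxy => ?_⟩⟩
      · have hxA := hS.1.1 hx
        rcases hle.1 (Or.inl hx) with h' | h' | h' | h'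
        · exact h'
        · exact absurd (hT'.1.1 h') (Set.disjoint_left.1 hd hxA)
        · rw [h']; exact hS'.2.2
        · rw [Set.mem_singleton_iff.1 h'] at hxA; exact absurd hxA haA
      · have hxA := hS.1.1 (S.edge_vert hxy)
        have hyA := hS.1.1 (S.edge_vert hxy.symm)
        rcases hle.2 (Or.inl hxy) with h' | h' | h'
        · exact h'
        · exact absurd (hT'.1.1 (T'.edge_vert h')) (Set.disjoint_left.1 hd hxA)
        · rw [SimpleGraph.subgraphOfAdj_adj, Sym2.eq_iff] at h'
          grind
      · have hxB := hT.1.1 hx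
        rcases hle.1 (Or.inr (Or.inl hx)) with h' | h' | h' | h'
        · exact absurd (hS'.1.1 h') (Set.disjoint_right.1 hd hxB)
        · exact h'
        · rw [h'] at hxB; exact absurd hxB hvB
        · rw [Set.mem_singleton_iff.1 h']; exact hT'.2.2
      · have hxB := hT.1.1 (T.edge_vert hxy)
        have hyB := hT.1.1 (T.edge_vert hxy.symm)
        rcases hle.2 (Or.inr (Or.inl hxy)) with h' | h' | h'
        · exact absurd (hS'.1.1 (S'.edge_vert h')) (Set.disjoint_right.1 hd hxB)
        · exact h'
        · rw [SimpleGraph.subgraphOfAdj_adj, Sym2.eq_iff] at h'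
          grind
    rintro ⟨S, T⟩ ⟨hS, hT⟩ ⟨S', T'⟩ ⟨hS', hT'⟩ heq
    have e1 := key S S' T T' hS hS' hT hT' heq.le
    have e2 := key S' S T' T hS' hS hT' hT heq.ge
    rw [le_antisymm e1.1 e2.1, le_antisymm e1.2 e2.2]
  have hfva : ∀ p, (f p).Adj v a := fun p => Or.inr (Or.inr (by simp))
  rw [h1]
  have h2 : (connIn A).ncard + (connIn B).ncard ≤ (connIn A ∪ connIn B).ncard := by
    refine ncard_add_le Set.subset_union_left Set.subset_union_right ?_
    rw [Set.disjoint_left]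
    intro S hS hS'
    obtain ⟨x, hx⟩ := hS.2.nonempty
    exact Set.disjoint_left.1 hd (hS.1.1 hx) (hS'.1.1 hx)
  refine (Nat.add_le_add_right h2 _).trans (ncard_add_le ?_ ?_ ?_)
  · rintro S (hS | hS)
    · exact ⟨hS.1.trans hA, hS.2⟩
    · exact ⟨hS.1.trans hB, hS.2⟩
  · rintro _ ⟨⟨S, T⟩, ⟨hS, hT⟩, rfl⟩
    refine ⟨sup_le (hS.1.trans hA) (sup_le (hT.1.trans hB) ?_), ?_⟩
    · exact SimpleGraph.subgraphOfAdj_le_of_adj K h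
    · refine SimpleGraph.Subgraph.connected_sup hS.2.1.preconnected
        (SimpleGraph.Subgraph.connected_sup hT.2.1.preconnected
          (SimpleGraph.Subgraph.subgraphOfAdj_connected hva).preconnected
          ⟨a, hT.2.2, by simp⟩).preconnected ⟨v, hS.2.2, Or.inr (by simp)⟩
  · rw [Set.disjoint_left]
    rintro _ (hS | hS) ⟨p, _, rfl⟩
    · exact haA (A.edge_vert (hS.1.2 (hfva p)).symm)
    · exact hvB (B.edge_vert (hS.1.2 (hfva p)))

end CoreIndex

/-! ### Five vertices and six edges: a finite check. -/

namespace CoreIndex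

/-- The edges of the complete graph on `{0, …, 4}`. -/
def edges : List (ℕ × ℕ) :=
  [(0, 1), (0, 2), (0, 3), (0, 4), (1, 2), (1, 3), (1, 4), (2, 3), (2, 4), (3, 4)]

/-- The sublists of a list. -/
def subs {α : Type*} : List α → List (List α)
  | [] => [[]]
  | a :: l => subs l ++ (subs l).map (List.cons a)

/-- Adds the ends of the edge `e` to the vertex set `r`, coded in binary, if one of them is in `r`. -/
def grow (r : ℕ) (e : ℕ × ℕ) : ℕ :=
  bif r.testBit e.1 || r.testBit e.2 then r ||| (2 ^ e.1 ||| 2 ^ e.2) else r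

/-- Whether three rounds of growth from the vertex `i` meet all edges of `s`. -/
def spans (s : List (ℕ × ℕ)) (i : ℕ) : Bool :=
  s.all fun e => (s.foldl grow (s.foldl grow (s.foldl grow (2 ^ i)))).testBit e.1

/-- A test for connectedness of a nonempty set of edges. -/
def connB : List (ℕ × ℕ) → Bool
  | [] => false
  | e :: s => spans (e :: s) e.1

/-- Whether every vertex is the end of an edge in `m`. -/
def covers (m : List (ℕ × ℕ)) : Bool :=
  (List.range 5).all fun i => m.any fun e => Nat.beq e.1 i || Nat.beq e.2 i

/-- Runs over all graphs with six edges and no isolated vertex on five labelled vertices. Only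
nonempty edge sets are counted; the five single vertices raise 49 to 54. -/
theorem check_five : ((subs edges).all fun m =>
    !(Nat.beq m.length 6) || (!(covers m) || Nat.ble 49 ((subs m).filter connB).length)) = true := by
  decide +kernel

theorem mem_subs {α : Type*} {l s : List α} : s ∈ subs l ↔ s.Sublist l := by
  have : subs l = l.sublists' := by
    induction l with
    | nil => rfl
    | cons a l ih => rw [List.sublists'_cons, subs, ih]
  rw [this, List.mem_sublists']

theorem nodup_subs {α : Type*} {l : List α} (h : l.Nodup) : (subs l).Nodup := by
  have : subs l = l.sublists' := by
    induction l with
    | nil => rfl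
    | cons a l ih => rw [List.sublists'_cons, subs, ih (List.nodup_cons.1 h).2]
  rw [this]
  exact List.nodup_sublists'.2 h

theorem nodup_edges : edges.Nodup := by decide

theorem lt_of_mem_edges {e : ℕ × ℕ} (he : e ∈ edges) : e.1 < e.2 ∧ e.2 < 5 := by
  revert e
  decide

theorem mem_edges {i j : ℕ} (hij : i < j) (hj : j < 5) : (i, j) ∈ edges := by
  interval_cases j <;> interval_cases i <;> decide

variable {V : Type*} (f : ℕ → V)

/-- The image of a list of edges. -/
def edgeGraph (s : List (ℕ × ℕ)) : (⊤ : SimpleGraph V).Subgraph where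
  verts := {x | ∃ e ∈ s, x = f e.1 ∨ x = f e.2}
  Adj x y := x ≠ y ∧ ∃ e ∈ s, (x = f e.1 ∧ y = f e.2) ∨ (x = f e.2 ∧ y = f e.1)
  adj_sub := fun h => h.1
  edge_vert := by
    rintro x y ⟨_, e, he, h | h⟩
    exacts [⟨e, he, Or.inl h.1⟩, ⟨e, he, Or.inr h.1⟩]
  symm := ⟨by
    rintro x y ⟨h, e, he, h'⟩
    exact ⟨h.symm, e, he, h'.symm.imp And.symm And.symm⟩⟩

variable {f} (hf : Set.InjOn f (Set.Iio 5))

include hf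

theorem edgeGraph_adj {s : List (ℕ × ℕ)} (hs : s ⊆ edges) {e : ℕ × ℕ} (he : e ∈ edges) :
    (edgeGraph f s).Adj (f e.1) (f e.2) ↔ e ∈ s := by
  obtain ⟨h1, h2⟩ := lt_of_mem_edges he
  constructor
  · rintro ⟨_, e', he', ⟨h3, h4⟩ | ⟨h3, h4⟩⟩ <;> obtain ⟨h5, h6⟩ := lt_of_mem_edges (hs he')
    · have e1 := hf (Set.mem_Iio.2 (by omega)) (Set.mem_Iio.2 (by omega)) h3
      have e2 := hf (Set.mem_Iio.2 (by omega)) (Set.mem_Iio.2 (by omega)) h4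
      rwa [Prod.ext e1 e2]
    · have e1 := hf (Set.mem_Iio.2 (by omega)) (Set.mem_Iio.2 (by omega)) h3
      have e2 := hf (Set.mem_Iio.2 (by omega)) (Set.mem_Iio.2 (by omega)) h4
      omega
  · intro h
    refine ⟨fun h3 => ?_, e, h, Or.inl ⟨rfl, rfl⟩⟩
    have e1 := hf (Set.mem_Iio.2 (by omega)) (Set.mem_Iio.2 (by omega)) h3
    omega

theorem edgeGraph_injOn : Set.InjOn (edgeGraph f) {s | s.Sublist edges} := by
  intro s hs t ht hst
  have hmem : ∀ e, e ∈ s ↔ e ∈ t := by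
    intro e
    by_cases he : e ∈ edges
    · rw [← edgeGraph_adj hf hs.subset he, hst, edgeGraph_adj hf ht.subset he]
    · exact ⟨fun h => absurd (hs.subset h) he, fun h => absurd (ht.subset h) he⟩
  have hp : s.Perm t := (List.perm_ext_iff_of_nodup (nodup_edges.sublist hs)
    (nodup_edges.sublist ht)).2 hmem
  -- `edges` lists the pairs (i, j) in increasing order of 5i + j, so a sublist is determined by its
  -- members.
  have hsort : edges.Pairwise fun p q => 5 * p.1 + p.2 < 5 * q.1 + q.2 := by decide
  exact hp.eq_of_pairwise (fun p q _ _ h1 h2 => absurd h1 (lt_asymm h2)) (hsort.sublist hs)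
    (hsort.sublist ht)

/-- Only soundness of the test is needed: growth adds nothing but reachable vertices. A connected
set missed by three rounds would merely go uncounted in a lower bound. -/
theorem edgeGraph_connected {s : List (ℕ × ℕ)} (hs : s ⊆ edges) (hc : connB s = true) :
    (edgeGraph f s).Connected := by
  match s, hc with
  | e₀ :: s', hc =>
    set s := e₀ :: s' with hs_def
    have hadj : ∀ e ∈ s, (edgeGraph f s).Adj (f e.1) (f e.2) := fun e he =>
      (edgeGraph_adj hf hs (hs he)).2 he
    have hgrow : ∀ (l : List (ℕ × ℕ)) (r : ℕ), l ⊆ s →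
        (∀ i, r.testBit i = true → ReflTransGen (edgeGraph f s).Adj (f e₀.1) (f i)) →
        ∀ i, (l.foldl grow r).testBit i = true →
          ReflTransGen (edgeGraph f s).Adj (f e₀.1) (f i) := by
      intro l
      induction l with
      | nil => exact fun r _ h => h
      | cons e l ih =>
        intro r hl hr
        rw [List.foldl_cons]
        refine ih _ (fun x hx => hl (List.mem_cons_of_mem _ hx)) fun i hi => ?_
        have he := hadj e (hl List.mem_cons_self)
        by_cases h : (r.testBit e.1 || r.testBit e.2) = true
        · have h1 : ReflTransGen (edgeGraph f s).Adj (f e₀.1) (f e.1) ∧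
              ReflTransGen (edgeGraph f s).Adj (f e₀.1) (f e.2) := by
            rcases Bool.or_eq_true_iff.1 h with h | h
            · exact ⟨hr _ h, (hr _ h).tail he⟩
            · exact ⟨(hr _ h).tail he.symm, hr _ h⟩
          rw [grow, h, cond_true, Nat.testBit_or, Nat.testBit_or, Nat.testBit_two_pow,
            Nat.testBit_two_pow] at hi
          simp only [Bool.or_eq_true, decide_eq_true_eq] at hi
          rcases hi with hi | rfl | rfl
          exacts [hr _ hi, h1.1, h1.2]
        · rw [Bool.not_eq_true] at h
          rw [grow, h, cond_false] at hi
          exact hr _ hi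
    have hall : ∀ e ∈ s, ReflTransGen (edgeGraph f s).Adj (f e₀.1) (f e.1) := by
      intro e he
      refine hgrow s _ (List.Subset.refl _) (hgrow s _ (List.Subset.refl _)
        (hgrow s _ (List.Subset.refl _) ?_)) _ (List.all_eq_true.1 hc e he)
      intro i hi
      rw [Nat.testBit_two_pow, decide_eq_true_eq] at hi
      rw [hi]
    refine connected_of_root (r := f e₀.1) ⟨e₀, List.mem_cons_self, Or.inl rfl⟩ ?_
    rintro x ⟨e, he, rfl | rfl⟩
    · exact hall e he
    · exact (hall e he).tail (hadj e he)

omit hf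

theorem exists_labelling [Finite V] {s : Set V} {n : ℕ} (hn : s.ncard = n + 1) :
    ∃ f : ℕ → V, Set.InjOn f (Set.Iio (n + 1)) ∧ f '' Set.Iio (n + 1) = s := by
  have e : s ≃ Fin (n + 1) := Finite.equivFinOfCardEq (by rw [Nat.card_coe_set_eq, hn])
  have hval : ∀ i (hi : i < n + 1), Fin.ofNat (n + 1) i = ⟨i, hi⟩ := fun i hi =>
    Fin.ext (Nat.mod_eq_of_lt hi)
  refine ⟨fun i => e.symm (Fin.ofNat (n + 1) i), fun i hi j hj hij => ?_, ?_⟩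
  · have := e.symm.injective (Subtype.ext hij)
    rw [hval i hi, hval j hj] at this
    exact Fin.mk.inj this
  · ext x
    constructor
    · rintro ⟨i, _, rfl⟩
      exact (e.symm _).2
    · intro hx
      refine ⟨e ⟨x, hx⟩, (e ⟨x, hx⟩).2, ?_⟩
      have := hval _ (e ⟨x, hx⟩).2
      simp only [this, Fin.eta, Equiv.symm_apply_apply]

theorem le_connIn_of_five [Finite V] {K : (⊤ : SimpleGraph V).Subgraph} (hK : K.Connected)
    (hn : K.verts.ncard = 5) (hd : (darts K).ncard = 12) : 54 ≤ (connIn K).ncard := by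
  classical
  obtain ⟨f, hf, hfK⟩ := exists_labelling hn
  set m := edges.filter fun e => decide (K.Adj (f e.1) (f e.2)) with hm_def
  have hm : m.Sublist edges := List.filter_sublist
  have hmem : ∀ e, e ∈ m ↔ e ∈ edges ∧ K.Adj (f e.1) (f e.2) := by
    intro e
    rw [hm_def, List.mem_filter, decide_eq_true_eq]
  have hedge : ∀ x y, K.Adj x y → ∃ e ∈ m, (x = f e.1 ∧ y = f e.2) ∨ (x = f e.2 ∧ y = f e.1) := by
    intro x y hxy
    have hx := K.edge_vert hxy
    have hy := K.edge_vert hxy.symm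
    rw [← hfK] at hx hy
    obtain ⟨i, hi : i < 5, rfl⟩ := hx
    obtain ⟨j, hj : j < 5, rfl⟩ := hy
    rcases lt_trichotomy i j with h | rfl | h
    · exact ⟨(i, j), (hmem _).2 ⟨mem_edges h hj, hxy⟩, Or.inl ⟨rfl, rfl⟩⟩
    · exact absurd rfl (K.adj_sub hxy).ne
    · exact ⟨(j, i), (hmem _).2 ⟨mem_edges h hi, hxy.symm⟩, Or.inr ⟨rfl, rfl⟩⟩
  have hlen : m.length = 6 := by
    have h1 : darts K = (fun p : (ℕ × ℕ) × Bool =>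
        if p.2 then (f p.1.1, f p.1.2) else (f p.1.2, f p.1.1)) ''
          (m.toFinset ×ˢ Finset.univ : Finset ((ℕ × ℕ) × Bool)) := by
      ext ⟨x, y⟩
      constructor
      · intro h
        obtain ⟨e, he, ⟨rfl, rfl⟩ | ⟨rfl, rfl⟩⟩ := hedge x y h
        · exact ⟨(e, true), by simpa using he, rfl⟩
        · exact ⟨(e, false), by simpa using he, rfl⟩
      · rintro ⟨⟨e, b⟩, he, hxy⟩
        have he : e ∈ m := by simpa using he
        have := ((hmem e).1 he).2
        cases b
        · obtain ⟨rfl, rfl⟩ := Prod.mk.inj hxy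
          exact this.symm
        · obtain ⟨rfl, rfl⟩ := Prod.mk.inj hxy
          exact this
    rw [h1, Set.InjOn.ncard_image, Set.ncard_coe_finset, Finset.card_product,
      List.toFinset_card_of_nodup (nodup_edges.sublist hm)] at hd
    · simp at hd
      omega
    · rintro ⟨e, b⟩ he ⟨e', b'⟩ he' heq
      have he : e ∈ m := by simpa using he
      have he' : e' ∈ m := by simpa using he'
      obtain ⟨h2, h3⟩ := lt_of_mem_edges (hm.subset he)
      obtain ⟨h4, h5⟩ := lt_of_mem_edges (hm.subset he')
      cases b <;> cases b' <;> simp only [if_true, Bool.false_eq_true, if_false, Prod.mk.injEq]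
        at heq <;>
      · have e1 := hf (Set.mem_Iio.2 (by omega)) (Set.mem_Iio.2 (by omega)) heq.1
        have e2 := hf (Set.mem_Iio.2 (by omega)) (Set.mem_Iio.2 (by omega)) heq.2
        first
        | omega
        | exact Prod.ext (Prod.ext (by assumption) (by assumption)) rfl
  -- Connectedness of `K` enters the finite check only by excluding isolated vertices.
  have hcov : covers m = true := by
    refine List.all_eq_true.2 fun i hi => ?_
    have hi : i < 5 := List.mem_range.1 hi
    have hfi : f i ∈ K.verts := hfK ▸ ⟨i, hi, rfl⟩
    obtain ⟨r, hr, hri⟩ := Set.exists_ne_of_one_lt_ncard (s := K.verts) (by omega) (f i)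
    obtain ⟨y, hy⟩ := exists_adj_of_connected hK hfi hr hri.symm
    obtain ⟨e, he, h⟩ := hedge _ _ hy
    obtain ⟨h1, h2⟩ := lt_of_mem_edges (hm.subset he)
    refine List.any_eq_true.2 ⟨e, he, ?_⟩
    rw [Bool.or_eq_true, Nat.beq_eq, Nat.beq_eq]
    rcases h with h | h
    · exact Or.inl (hf (Set.mem_Iio.2 (by omega)) hi h.1.symm)
    · exact Or.inr (hf (Set.mem_Iio.2 (by omega)) hi h.1.symm)
  have hcount : 49 ≤ ((subs m).filter connB).length := by
    have := List.all_eq_true.1 check_five m (mem_subs.2 hm)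
    rw [hlen, hcov] at this
    simpa using this
  have hsing : (Γ₀ : SimpleGraph V) → (Γ₀.singletonSubgraph '' K.verts).ncard = 5 := by
    intro Γ₀
    rw [Set.ncard_image_of_injective, hn]
    intro x y hxy
    have : x ∈ (Γ₀.singletonSubgraph y).verts := hxy ▸ rfl
    exact this
  have hsub : ∀ s ∈ (subs m).filter connB, s.Sublist m ∧ connB s = true := fun s hs =>
    ⟨mem_subs.1 (List.mem_filter.1 hs).1, (List.mem_filter.1 hs).2⟩
  have himg : (edgeGraph f '' (((subs m).filter connB).toFinset : Set (List (ℕ × ℕ)))).ncard =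
      ((subs m).filter connB).length := by
    rw [Set.InjOn.ncard_image, Set.ncard_coe_finset, List.toFinset_card_of_nodup]
    · exact (nodup_subs (nodup_edges.sublist hm)).filter _
    · refine (edgeGraph_injOn hf).mono fun s hs => ?_
      exact (hsub s (List.mem_toFinset.1 hs)).1.trans hm
  -- Single vertices have no edge and the images of the listed sets have at least one, so the two
  -- families are disjoint.
  have hfin := ncard_add_le (A := (⊤ : SimpleGraph V).singletonSubgraph '' K.verts)
    (B := edgeGraph f '' (((subs m).filter connB).toFinset : Set (List (ℕ × ℕ))))
    (C := connIn K) ?_ ?_ ?_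
  · rw [hsing, himg] at hfin
    omega
  · rintro _ ⟨x, hx, rfl⟩
    exact connAt_subset _ _ (singleton_mem_connAt hx)
  · rintro _ ⟨s, hs, rfl⟩
    obtain ⟨h1, h2⟩ := hsub s (List.mem_toFinset.1 hs)
    refine ⟨⟨?_, ?_⟩, edgeGraph_connected hf (h1.trans hm).subset h2⟩
    · rintro x ⟨e, he, rfl | rfl⟩
      · exact K.edge_vert ((hmem e).1 (h1.subset he)).2
      · exact K.edge_vert ((hmem e).1 (h1.subset he)).2.symm
    · rintro x y ⟨_, e, he, ⟨rfl, rfl⟩ | ⟨rfl, rfl⟩⟩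
      · exact ((hmem e).1 (h1.subset he)).2
      · exact ((hmem e).1 (h1.subset he)).2.symm
  · rw [Set.disjoint_left]
    rintro _ ⟨x, _, rfl⟩ ⟨s, hs, heq⟩
    obtain ⟨h1, h2⟩ := hsub s (List.mem_toFinset.1 hs)
    match s, h2 with
    | e :: s', _ =>
      have : (edgeGraph f (e :: s')).Adj (f e.1) (f e.2) :=
        (edgeGraph_adj hf (h1.trans hm).subset ((h1.trans hm).subset List.mem_cons_self)).2
          List.mem_cons_self
      rw [heq] at this
      exact this

end CoreIndex

/-! ### Degree sums and the 2-regular case. -/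

namespace CoreIndex

variable {V : Type*} [Finite V]

theorem darts_eq_sum {Γ : SimpleGraph V} (K : Γ.Subgraph) : (darts K).ncard =
    ∑ x ∈ (Set.toFinite K.verts).toFinset, (K.neighborSet x).ncard := by
  classical
  rw [Set.ncard_eq_toFinset_card _ (Set.toFinite (darts K)),
    Finset.card_eq_sum_card_fiberwise (f := Prod.fst) (t := (Set.toFinite K.verts).toFinset)]
  · refine Finset.sum_congr rfl fun x _ => ?_
    rw [← Set.ncard_coe_finset, ← Set.ncard_image_of_injective (K.neighborSet x)
      (Prod.mk_right_injective x)]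
    congr 1
    ext ⟨p, q⟩
    simp only [Finset.coe_filter, Set.Finite.mem_toFinset, Set.mem_ofPred_eq, Set.mem_image,
      Prod.mk.injEq, darts, SimpleGraph.Subgraph.mem_neighborSet]
    constructor
    · rintro ⟨h, rfl⟩
      exact ⟨q, h, rfl, rfl⟩
    · rintro ⟨_, h, rfl, rfl⟩
      exact ⟨h, rfl⟩
  · rintro ⟨p, q⟩ h
    simp only [Set.Finite.coe_toFinset] at h ⊢
    exact K.edge_vert h

/-- Vertices outside `s` contribute at least two each, so the excess of degrees over two on `s` is
at most the total excess. With n + 1 edges that total is 2. -/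
theorem sum_degrees_le {Γ : SimpleGraph V} {K : Γ.Subgraph}
    (hdeg : ∀ x ∈ K.verts, 2 ≤ (K.neighborSet x).ncard) (s : Finset V) (hs : ∀ x ∈ s, x ∈ K.verts) :
    ∑ x ∈ s, (K.neighborSet x).ncard + 2 * K.verts.ncard ≤ (darts K).ncard + 2 * s.card := by
  classical
  have hsub : s ⊆ (Set.toFinite K.verts).toFinset := fun x hx => by simpa using hs x hx
  rw [darts_eq_sum, ← Finset.sum_sdiff hsub, Set.ncard_eq_toFinset_card _ (Set.toFinite K.verts),
    ← Finset.card_sdiff_add_card_eq_card hsub]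
  have : ((Set.toFinite K.verts).toFinset \ s).card * 2 ≤
      ∑ x ∈ (Set.toFinite K.verts).toFinset \ s, (K.neighborSet x).ncard := by
    refine Finset.card_nsmul_le_sum _ _ _ fun x hx => hdeg x ?_
    simpa using (Finset.mem_sdiff.1 hx).1
  omega

theorem eq_two_of_darts {Γ : SimpleGraph V} {K : Γ.Subgraph}
    (hdeg : ∀ x ∈ K.verts, 2 ≤ (K.neighborSet x).ncard)
    (hd : (darts K).ncard = 2 * K.verts.ncard) {x : V} (hx : x ∈ K.verts) :
    (K.neighborSet x).ncard = 2 := by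
  have h1 := sum_degrees_le hdeg {x} (by simpa using hx)
  have h2 := hdeg x hx
  simp at h1
  omega

variable {K : (⊤ : SimpleGraph V).Subgraph} {v a : V}

/-- The merged vertex inherits one further neighbour from `v` and one from `a`, distinct because the
two have none in common. For the same reason no other vertex sees two of its neighbours merge. -/
theorem contract_two_le (h : K.Adj v a) (hno : ∀ x, K.Adj v x → ¬ K.Adj a x)
    (hdeg : ∀ x ∈ K.verts, 2 ≤ (K.neighborSet x).ncard) :
    ∀ x ∈ (contract K v a).verts, 2 ≤ ((contract K v a).neighborSet x).ncard := by
  intro x hx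
  rw [contract_verts h] at hx
  obtain ⟨hxK, hxv : x ≠ v⟩ := hx
  refine (Set.one_lt_ncard_iff (Set.toFinite _)).2 ?_
  by_cases hxa : x = a
  · subst hxa
    obtain ⟨p, hp, hpa⟩ := Set.exists_ne_of_one_lt_ncard (hdeg v (K.edge_vert h)) x
    obtain ⟨q, hq, hqv⟩ := Set.exists_ne_of_one_lt_ncard (hdeg x hxK) v
    have hp : K.Adj v p := hp
    have hq : K.Adj x q := hq
    refine ⟨p, q, ⟨hpa.symm, v, p, collapse_self _ _, ?_, hp⟩,
      ⟨(K.adj_sub hq).ne, x, q, collapse_of_ne hxv, collapse_of_ne hqv, hq⟩, ?_⟩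
    · exact collapse_of_ne (K.adj_sub hp).ne'
    · rintro rfl
      exact hno _ hp hq
  · obtain ⟨p, q, hp, hq, hpq⟩ := (Set.one_lt_ncard_iff (Set.toFinite _)).1 (hdeg x hxK)
    have hp : K.Adj x p := hp
    have hq : K.Adj x q := hq
    have hx' := collapse_of_ne (a := a) hxv
    have hmem : ∀ p, K.Adj x p → (contract K v a).Adj x (collapse v a p) := by
      intro p hp
      refine ⟨?_, x, p, hx', rfl, hp⟩
      have := (K.adj_sub hp).ne
      nth_rw 1 [← hx']
      rw [Ne, collapse_eq_iff]
      tauto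
    refine ⟨_, _, hmem p hp, hmem q hq, ?_⟩
    rw [Ne, collapse_eq_iff]
    rintro (h' | ⟨rfl, rfl⟩ | ⟨rfl, rfl⟩)
    · exact hpq h'
    · exact hno x hp.symm hq.symm
    · exact hno x hq.symm hp.symm

theorem neighborSet_eq_pair {Γ : SimpleGraph V} {K : Γ.Subgraph} {x p q : V}
    (h2 : (K.neighborSet x).ncard ≤ 2)
    (hp : K.Adj x p) (hq : K.Adj x q) (hpq : p ≠ q) : ∀ y, K.Adj x y → y = p ∨ y = q := by
  have : ({p, q} : Set V) = K.neighborSet x := by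
    refine Set.eq_of_subset_of_ncard_le ?_ (by rw [Set.ncard_pair hpq]; exact h2) (Set.toFinite _)
    rintro y (rfl | rfl)
    exacts [hp, hq]
  intro y hy
  have hy : y ∈ K.neighborSet x := hy
  rw [← this] at hy
  exact hy

theorem ncard_le_of_closed {Γ : SimpleGraph V} {K : Γ.Subgraph} (hK : K.Connected) {r : V}
    (hr : r ∈ K.verts) (s : Finset V) (hrs : r ∈ s) (hs : ∀ x y, K.Adj x y → x ∈ s → y ∈ s) :
    K.verts.ncard ≤ s.card := by
  rw [← Set.ncard_coe_finset s]
  exact Set.ncard_le_ncard (subset_of_closed hK hr hrs hs) (Set.toFinite _)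

/-- A connected 2-regular graph on `n` vertices has at least `n ^ 2 + 1` connected subgraphs. -/
theorem sq_add_one_le_connIn (hK : K.Connected)
    (hdeg : ∀ x ∈ K.verts, 2 ≤ (K.neighborSet x).ncard)
    (hd : (darts K).ncard = 2 * K.verts.ncard) :
    K.verts.ncard ^ 2 + 1 ≤ (connIn K).ncard := by
  classical
  induction hn : K.verts.ncard generalizing K with
  | zero => have := three_le_of_darts hK hd.ge; omega
  | succ k ih =>
    have h3 := three_le_of_darts hK hd.ge
    rcases (show 2 ≤ k by omega).eq_or_lt with rfl | hk
    · simpa using ten_le_connIn hK hn (by omega)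
    obtain ⟨v, hv, hc⟩ := exists_noncut' hK (by omega)
    obtain ⟨a, b, ha, hb, hab⟩ := (Set.one_lt_ncard_iff (Set.toFinite _)).1 (hdeg v hv)
    have ha : K.Adj v a := ha
    have hb : K.Adj v b := hb
    have h2 : ∀ x y z w, K.Adj x y → K.Adj x z → y ≠ z → K.Adj x w → w = y ∨ w = z :=
      fun x y z w hy hz hyz hw =>
        neighborSet_eq_pair (eq_two_of_darts hdeg hd (K.edge_vert hy)).le hy hz hyz w hw
    have hav := (K.adj_sub ha).ne
    have hbv := (K.adj_sub hb).ne
    -- If the neighbours of `v` are adjacent, the triangle is closed under adjacency and hence all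
    -- of `K`, contrary to n > 3.
    by_cases hadj : K.Adj a b
    · exfalso
      have := ncard_le_of_closed hK hv {v, a, b} (by simp) (by
        intro x y hxy hx
        simp only [Finset.mem_insert, Finset.mem_singleton] at hx ⊢
        rcases hx with rfl | rfl | rfl
        · have := h2 _ _ _ _ ha hb hab hxy; tauto
        · have := h2 _ _ _ _ ha.symm hadj hbv hxy; tauto
        · have := h2 _ _ _ _ hb.symm hadj.symm hav hxy; tauto)
      have := Finset.card_le_three (a := v) (b := a) (c := b)
      omega
    have hno : ∀ x, K.Adj v x → ¬ K.Adj a x := by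
      intro x hx hax
      rcases h2 _ _ _ _ ha hb hab hx with rfl | rfl
      · exact (K.adj_sub hax).ne rfl
      · exact hadj hax
    have e1 := contract_ncard ha
    have e2 := contract_darts ha hno
    have e0 : (contract K v a).Connected := image_connected hK
    have e3 := ih e0 (contract_two_le ha hno hdeg) (by omega) (by omega)
    -- K - va and K - v are connected on n and n - 1 vertices, and n + (n - 1) is exactly n² - (n -
    -- 1)².
    have e4 := contract_add_le ha (delE_le K v a) (del_le K v) (by simp) (by simp)
    have e5 := ncard_verts_le_connAt (delE_connected hc hb hab.symm) (u := v) hv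
    have e6 := ncard_verts_le_connAt hc (u := a) ⟨K.edge_vert ha.symm, hav.symm⟩
    have e7 := ncard_del hv
    have e8 : (delE K v a).verts.ncard = K.verts.ncard := rfl
    nlinarith

/-! ### Bridgeless graphs with n + 1 edges whose degree-two vertices all lie in triangles. -/

section Bicyclic

variable (hK : K.Connected) (hn : 6 ≤ K.verts.ncard)
  (hdeg : ∀ x ∈ K.verts, 2 ≤ (K.neighborSet x).ncard)
  (hd : (darts K).ncard = 2 * K.verts.ncard + 2)
  (hbr : ∀ x y, K.Adj x y → (delE K x y).Connected)
  (htri : ∀ v a b, K.Adj v a → K.Adj v b → a ≠ b → (∀ x, K.Adj v x → x = a ∨ x = b) → K.Adj a b)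

include hK hn hdeg hd hbr htri

/-- Since there is no bridge, a triangle attached only at `b` forces two further neighbours of `b`.
That uses up the whole degree excess, so every other vertex has degree two, and the triangle
condition closes a second triangle at `b`. The result is two triangles sharing a vertex, with only
five vertices. -/
theorem no_pendant_triangle {b : V} (ha : K.Adj v a) (hb : K.Adj v b) (hab : K.Adj a b)
    (hv2 : ∀ x, K.Adj v x → x = a ∨ x = b) (ha2 : ∀ x, K.Adj a x → x = v ∨ x = b) : False := by
  classical
  have hav := (K.adj_sub ha).ne
  have hbv := (K.adj_sub hb).ne
  have hab' := (K.adj_sub hab).ne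
  have hvK := K.edge_vert ha
  obtain ⟨c, hc, hcv, hca⟩ : ∃ c, K.Adj b c ∧ c ≠ v ∧ c ≠ a := by
    by_contra! hcon
    have h1 := ncard_le_of_closed hK hvK {v, a, b} (by simp) (by
      intro x y hxy hx
      simp only [Finset.mem_insert, Finset.mem_singleton] at hx ⊢
      rcases hx with rfl | rfl | rfl
      · have := hv2 _ hxy; tauto
      · have := ha2 _ hxy; tauto
      · have := hcon _ hxy; tauto)
    have := Finset.card_le_three (a := v) (b := a) (c := b)
    omega
  have hcb := (K.adj_sub hc).ne
  -- If `c` were the only neighbour of `b` outside the triangle, `bc` would be a bridge.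
  obtain ⟨d, hd', hdv, hda, hdc⟩ : ∃ d, K.Adj b d ∧ d ≠ v ∧ d ≠ a ∧ d ≠ c := by
    by_contra! hcon
    have hcl := subset_of_closed (hbr b c hc) (X := {v, a, b}) (r := v) hvK (by simp) (by
      intro x y hxy hx
      obtain ⟨hxy', hne⟩ := delE_adj.1 hxy
      simp only [Set.mem_insert_iff, Set.mem_singleton_iff] at hx ⊢
      rcases hx with rfl | rfl | rfl
      · have := hv2 _ hxy'; tauto
      · have := ha2 _ hxy'; tauto
      · have := hcon y hxy'; tauto)
    have : c ∈ ({v, a, b} : Set V) := hcl (show c ∈ K.verts from K.edge_vert hc.symm)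
    simp only [Set.mem_insert_iff, Set.mem_singleton_iff] at this
    rcases this with h | h | h
    exacts [hcv h, hca h, hcb h.symm]
  have hdb := (K.adj_sub hd').ne
  have hbK := K.edge_vert hc
  have hcard : ({v, a, c, d} : Finset V).card = 4 := by
    rw [Finset.card_insert_of_notMem, Finset.card_insert_of_notMem, Finset.card_pair] <;> grind
  have hsub : ((({v, a, c, d} : Finset V) : Set V)) ⊆ K.neighborSet b := by
    intro x hx
    simp only [Finset.coe_insert, Finset.coe_singleton, Set.mem_insert_iff,
      Set.mem_singleton_iff] at hx
    rcases hx with rfl | rfl | rfl | rfl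
    exacts [hb.symm, hab.symm, hc, hd']
  have hb4 : 4 ≤ (K.neighborSet b).ncard := by
    rw [← hcard, ← Set.ncard_coe_finset]
    exact Set.ncard_le_ncard hsub (Set.toFinite _)
  have hpair : ∀ x ∈ K.verts, x ≠ b →
      (K.neighborSet b).ncard ≤ 4 ∧ (K.neighborSet x).ncard ≤ 2 := by
    intro x hx hxb
    have h1 := sum_degrees_le hdeg {b, x} (by simp [hx, hbK])
    rw [Finset.sum_pair hxb.symm, Finset.card_pair hxb.symm] at h1
    have := hdeg x hx
    omega
  have hbN : ∀ x, K.Adj b x → x = v ∨ x = a ∨ x = c ∨ x = d := by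
    intro x hx
    have : (({v, a, c, d} : Finset V) : Set V) = K.neighborSet b := by
      refine Set.eq_of_subset_of_ncard_le hsub ?_ (Set.toFinite _)
      rw [Set.ncard_coe_finset, hcard]
      exact (hpair v hvK hbv).1
    have hx : x ∈ K.neighborSet b := hx
    rw [← this] at hx
    simpa using hx
  have hcK := K.edge_vert hc.symm
  have hdK := K.edge_vert hd'.symm
  obtain ⟨e, he, heb⟩ := Set.exists_ne_of_one_lt_ncard (hdeg c hcK) b
  have he : K.Adj c e := he
  have hcN := neighborSet_eq_pair (hpair c hcK hcb.symm).2 hc.symm he heb.symm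
  have hbe := htri c b e hc.symm he heb.symm hcN
  have hed : e = d := by
    rcases hbN e hbe with rfl | rfl | rfl | rfl
    · rcases hv2 c he.symm with h | h <;> tauto
    · rcases ha2 c he.symm with h | h <;> tauto
    · exact absurd rfl (K.adj_sub he).ne
    · rfl
  subst hed
  have hdN := neighborSet_eq_pair (hpair e hdK hdb.symm).2 hd'.symm he.symm hcb
  have h1 := ncard_le_of_closed hK hvK {v, a, b, c, e} (by simp) (by
    intro x y hxy hx
    simp only [Finset.mem_insert, Finset.mem_singleton] at hx ⊢
    rcases hx with rfl | rfl | rfl | rfl | rfl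
    · have := hv2 _ hxy; tauto
    · have := ha2 _ hxy; tauto
    · have := hbN _ hxy; tauto
    · have := hcN _ hxy; tauto
    · have := hdN _ hxy; tauto)
  have := Finset.card_le_five (a := v) (b := a) (c := b) (d := c) (e := e)
  omega

/-- A vertex `v` of degree two exists, since otherwise 3n ≤ 2n + 2. Its neighbours `a`, `b` are
adjacent. If either has degree two there is a pendant triangle; otherwise both have degree three and
carry all the excess. The third neighbour of `a` then has degree two, and the triangle condition
joins it to `b`, leaving K₄ minus an edge. -/
theorem no_reduced_bicyclic : False := by
  classical
  obtain ⟨v, hvK, hv2⟩ : ∃ v ∈ K.verts, (K.neighborSet v).ncard ≤ 2 := by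
    by_contra! hcon
    have h1 := darts_eq_sum K
    have h2 : (Set.toFinite K.verts).toFinset.card * 3 ≤
        ∑ x ∈ (Set.toFinite K.verts).toFinset, (K.neighborSet x).ncard :=
      Finset.card_nsmul_le_sum _ (fun x => (K.neighborSet x).ncard) 3 fun x hx =>
        hcon x (by simpa using hx)
    rw [← Set.ncard_eq_toFinset_card] at h2
    omega
  obtain ⟨a, b, ha, hb, hab⟩ := (Set.one_lt_ncard_iff (Set.toFinite _)).1 (hdeg v hvK)
  have ha : K.Adj v a := ha
  have hb : K.Adj v b := hb
  have hvN := neighborSet_eq_pair hv2 ha hb hab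
  have hadj := htri v a b ha hb hab hvN
  have hav := (K.adj_sub ha).ne
  have hbv := (K.adj_sub hb).ne
  have haK := K.edge_vert ha.symm
  have hbK := K.edge_vert hb.symm
  by_cases ha2 : (K.neighborSet a).ncard ≤ 2
  · exact no_pendant_triangle hK hn hdeg hd hbr htri ha hb hadj hvN
      (neighborSet_eq_pair ha2 ha.symm hadj hbv)
  by_cases hb2 : (K.neighborSet b).ncard ≤ 2
  · exact no_pendant_triangle hK hn hdeg hd hbr htri hb ha hadj.symm (fun x hx => (hvN x hx).symm)
      (neighborSet_eq_pair hb2 hb.symm hadj.symm hav)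
  have hthree : ∀ p q, K.Adj p v → K.Adj p q → v ≠ q → (K.neighborSet p).ncard = 3 →
      ∃ x, K.Adj p x ∧ x ≠ v ∧ x ≠ q ∧ ∀ y, K.Adj p y → y = v ∨ y = q ∨ y = x := by
    intro p q hpv hpq hvq h3
    have hpv : v ∈ K.neighborSet p := hpv
    have h1 := Set.ncard_sdiff_singleton_add_one hpv (Set.toFinite _)
    obtain ⟨x, hx, hxq⟩ := Set.exists_ne_of_one_lt_ncard (s := K.neighborSet p \ {v}) (by omega) q
    refine ⟨x, hx.1, hx.2, hxq, fun y hy => ?_⟩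
    by_contra! hcon
    have h2 : ({q, x, y} : Set V) ⊆ K.neighborSet p \ {v} := by
      rintro z (rfl | rfl | rfl)
      exacts [⟨hpq, hvq.symm⟩, hx, ⟨hy, hcon.1⟩]
    have h3 := Set.ncard_le_ncard h2 (Set.toFinite _)
    rw [Set.ncard_eq_three.2 ⟨q, x, y, hxq.symm, hcon.2.1.symm, hcon.2.2.symm, rfl⟩] at h3
    omega
  have hsum2 := sum_degrees_le hdeg {a, b} (by simp [haK, hbK])
  rw [Finset.sum_pair hab, Finset.card_pair hab] at hsum2
  obtain ⟨x, hx, hxv, hxb, haN⟩ := hthree a b ha.symm hadj hbv (by omega)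
  obtain ⟨y, hy, hyv, hya, hbN⟩ := hthree b a hb.symm hadj.symm hav (by omega)
  have hxa := (K.adj_sub hx).ne'
  have hxK := K.edge_vert hx.symm
  have hx2 : (K.neighborSet x).ncard ≤ 2 := by
    have h1 := sum_degrees_le hdeg {x, a, b} (by simp [haK, hbK, hxK])
    rw [Finset.sum_insert (by simp [hxa, hxb]), Finset.sum_pair hab,
      Finset.card_insert_of_notMem (by simp [hxa, hxb]), Finset.card_pair hab] at h1
    omega
  obtain ⟨e, he, hea⟩ := Set.exists_ne_of_one_lt_ncard (hdeg x hxK) a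
  have he : K.Adj x e := he
  have hxN := neighborSet_eq_pair hx2 hx.symm he hea.symm
  have heb : e = b := by
    rcases haN e (htri x a e hx.symm he hea.symm hxN) with rfl | rfl | rfl
    · rcases hvN x he.symm with h | h <;> tauto
    · rfl
    · exact absurd rfl (K.adj_sub he).ne
  subst heb
  have hxy : x = y := by
    rcases hbN x he.symm with h | h | h <;> tauto
  subst hxy
  have h1 := ncard_le_of_closed hK hvK {v, a, e, x} (by simp) (by
    intro p q hpq hp
    simp only [Finset.mem_insert, Finset.mem_singleton] at hp ⊢
    rcases hp with rfl | rfl | rfl | rfl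
    · have := hvN _ hpq; tauto
    · have := haN _ hpq; tauto
    · have := hbN _ hpq; tauto
    · have := hxN _ hpq; tauto)
  have := Finset.card_le_four (a := v) (b := a) (c := e) (d := x)
  omega

end Bicyclic

/-! ### Reduction to n + 1 edges and the bound (n² + 17n)/2. -/

theorem exists_bicyclic {Γ : SimpleGraph V} {K : Γ.Subgraph} (hK : K.Connected)
    (hd : 2 * K.verts.ncard + 2 ≤ (darts K).ncard) : ∃ L ≤ K, L.Connected ∧ L.verts = K.verts ∧
      (darts L).ncard = 2 * K.verts.ncard + 2 := by
  induction hm : (darts K).ncard using Nat.strong_induction_on generalizing K with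
  | _ m ih =>
    rcases hd.eq_or_lt with h | h
    · exact ⟨K, le_rfl, hK, rfl, h.symm⟩
    -- Deleting a non-bridge costs two darts; by parity the count stays at least 2n + 2.
    obtain ⟨x, y, hxy, hc⟩ := exists_nonbridge hK (by omega)
    have h1 := darts_delE hxy
    have h2 := darts_even K
    have hv : (delE K x y).verts = K.verts := rfl
    obtain ⟨L, hL, hLc, hLv, hLd⟩ := ih _ (by omega) hc (by rw [hv]; omega) rfl
    exact ⟨L, hL.trans (delE_le _ _ _), hLc, hLv, hLd⟩

/-- The only edge at a vertex would be a bridge. -/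
theorem two_le_degree (hK : K.Connected) (hn : 2 ≤ K.verts.ncard)
    (hbr : ∀ x y, K.Adj x y → (delE K x y).Connected) :
    ∀ x ∈ K.verts, 2 ≤ (K.neighborSet x).ncard := by
  intro x hx
  obtain ⟨r, hr, hrx⟩ := Set.exists_ne_of_one_lt_ncard (s := K.verts) hn x
  obtain ⟨y, hy⟩ := exists_adj_of_connected hK hx hr hrx.symm
  obtain ⟨z, hz⟩ := exists_adj_of_connected (hbr x y hy) hx hr hrx.symm
  obtain ⟨h1, h2⟩ := delE_adj.1 hz
  exact (Set.one_lt_ncard_iff (Set.toFinite _)).2 ⟨y, z, hy, h1, by rintro rfl; tauto⟩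

/-- A connected graph on `n ≥ 6` vertices with at least `n + 1` edges has at least
`(n ^ 2 + 17 n) / 2` connected subgraphs. -/
theorem le_connIn_of_bicyclic (hK : K.Connected) (hn : 6 ≤ K.verts.ncard)
    (hd : 2 * K.verts.ncard + 2 ≤ (darts K).ncard) :
    K.verts.ncard ^ 2 + 17 * K.verts.ncard ≤ 2 * (connIn K).ncard := by
  induction hk : K.verts.ncard generalizing K with
  | zero => omega
  | succ k ih =>
    obtain ⟨L, hL, hLc, hLv, hLd⟩ := exists_bicyclic hK hd
    have hmono := ncard_connIn_mono hL
    rw [← hLv] at hn hLd hk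
    refine le_trans ?_ (Nat.mul_le_mul_left 2 hmono)
    clear hmono hL hLv hd hK K
    -- With n = k + 1, half the increase of n² + 17n over its value at n - 1 is n + 8. At n = 6 the
    -- base value is 54, and 69 - 54 = 15 = n + 9.
    have hcontr : ∀ v a, L.Adj v a → (∀ x, L.Adj v x → ¬ L.Adj a x) → ∀ g,
        (connIn (contract L v a)).ncard + g ≤ (connIn L).ncard → k + 1 + 8 ≤ g →
        (k + 1 = 6 → k + 1 + 9 ≤ g) → (k + 1) ^ 2 + 17 * (k + 1) ≤ 2 * (connIn L).ncard := by
      intro v a hva hno g h1 h2 h3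
      have e1 := contract_ncard hva
      have e2 := contract_darts hva hno
      have e3 : (contract L v a).Connected := image_connected hLc
      rcases (show 5 ≤ k by omega).eq_or_lt with rfl | h5
      · have := le_connIn_of_five e3 (by omega) (by omega)
        have := h3 rfl
        omega
      · have := ih e3 (by omega) (by omega) (by omega)
        nlinarith
    by_cases hbr : ∀ x y, L.Adj x y → (delE L x y).Connected
    · by_cases htri : ∀ v a b, L.Adj v a → L.Adj v b → a ≠ b →
          (∀ x, L.Adj v x → x = a ∨ x = b) → L.Adj a b
      · exact (no_reduced_bicyclic hLc hn (two_le_degree hLc (by omega) hbr) hLd hbr htri).elim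
      · push Not at htri
        obtain ⟨v, a, b, ha, hb, hab, hN, hnadj⟩ := htri
        have hno : ∀ x, L.Adj v x → ¬ L.Adj a x := by
          intro x hx hax
          rcases hN x hx with rfl | rfl
          · exact (L.adj_sub hax).ne rfl
          · exact hnadj hax
        have hc := hbr v a ha
        have hv := L.edge_vert ha
        have e1 := darts_delE ha
        have e2 := add_four_le_connAt hc (u := v) hv (by
          rw [show (delE L v a).verts = L.verts from rfl]; omega)
        rw [show (delE L v a).verts = L.verts from rfl] at e2
        have e3 := ncard_verts_le_connAt (del_connected hc hb hN) (u := a)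
          ⟨L.edge_vert ha.symm, (L.adj_sub ha).ne'⟩
        have e4 := ncard_del hv
        -- The gain is (n + 4) + (n - 1) = 2n + 3, which is at least n + 8 and equals n + 9 at n =
        -- 6.
        have e5 := contract_add_le ha (delE_le L v a) (del_le L v) (by simp) (by simp)
        rw [add_assoc] at e5
        exact hcontr v a ha hno _ e5 (by omega) (by omega)
    · push Not at hbr
      obtain ⟨v, a, ha, hbr⟩ := hbr
      obtain ⟨A, hA, B, hB, hAc, hBc, hvA, haB, hAB, hcard, hdarts⟩ := exists_sides hLc ha hbr
      -- A common neighbour of `v` and `a` would be a detour around the bridge.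
      have hno : ∀ x, L.Adj v x → ¬ L.Adj a x := by
        intro x hx hax
        refine hbr (connected_of_root (r := v) (L.edge_vert ha) fun y hy => ?_)
        have hxv := (L.adj_sub hx).ne'
        have hxa := (L.adj_sub hax).ne'
        have hva := (L.adj_sub ha).ne
        have e1 : (delE L v a).Adj v x := delE_adj.2 ⟨hx, by tauto⟩
        have e2 : (delE L v a).Adj x a := delE_adj.2 ⟨hax.symm, by tauto⟩
        have e3 : ReflTransGen (delE L v a).Adj v a := .tail (.single e1) e2
        have := reach hLc (L.edge_vert ha) hy
        induction this with
        | refl => exact .refl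
        | @tail p q _ hpq ih' =>
          have ih'' := ih' (L.edge_vert hpq)
          by_cases he : p = v ∧ q = a ∨ p = a ∧ q = v
          · rcases he with ⟨_, rfl⟩ | ⟨_, rfl⟩
            · exact e3
            · exact .refl
          · exact ih''.tail (delE_adj.2 ⟨hpq, he⟩)
      have haA : a ∉ A.verts := Set.disjoint_right.1 hAB haB
      have e5 := contract_add_le ha hA hB (fun h => haA (A.edge_vert h.symm))
        (Set.disjoint_left.1 hAB hvA)
      rw [add_assoc] at e5
      have hA1 := le_darts_of_connected hAc
      have hB1 := le_darts_of_connected hBc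
      have hA2 := darts_even A
      have hB2 := darts_even B
      have hA3 := ncard_verts_le_connAt hAc hvA
      have hB3 := ncard_verts_le_connAt hBc haB
      -- The sides together have n edges. If one has two independent cycles, the gain is n + 9;
      -- otherwise each has exactly one and the gain is n + 8.
      by_cases hA4 : 2 * A.verts.ncard + 2 ≤ (darts A).ncard
      · have := add_nine_le_connAt hAc hvA hA4
        exact hcontr v a ha hno _ e5 (by omega) (by omega)
      by_cases hB4 : 2 * B.verts.ncard + 2 ≤ (darts B).ncard
      · have := add_nine_le_connAt hBc haB hB4
        exact hcontr v a ha hno _ e5 (by omega) (by omega)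
      have hA5 : 2 * A.verts.ncard ≤ (darts A).ncard := by omega
      have hB5 : 2 * B.verts.ncard ≤ (darts B).ncard := by omega
      have hA6 := add_four_le_connAt hAc hvA hA5
      have hB6 := add_four_le_connAt hBc haB hB5
      -- Both sides are triangles when n = 6. Counting the subgraphs on each side and across the
      -- bridge gives 10 + 10 + 7 · 7 = 69, exactly the bound.
      by_cases h6 : k + 1 = 6
      · have hA7 := three_le_of_darts hAc hA5
        have hB7 := three_le_of_darts hBc hB5
        have hA8 := ten_le_connIn hAc (by omega) (by omega)
        have hB8 := ten_le_connIn hBc (by omega) (by omega)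
        have h9 := bridge_le ha hA hB hvA haB hAB
        have h10 : 7 * 7 ≤ (connAt v A).ncard * (connAt a B).ncard :=
          Nat.mul_le_mul (by omega) (by omega)
        rw [h6]
        omega
      · exact hcontr v a ha hno _ e5 (by omega) (by omega)

end CoreIndex

namespace CoreIndex

variable {V : Type*} {Γ : SimpleGraph V}

theorem coreIndex_eq (G : SimpleGraph V) :
    coreIndex G = (connIn (⊤ : G.Subgraph)).ncard := by
  simp [coreIndex, connIn]

/-! ### Upper bounds for path-like subgraphs. -/

section Path

variable {d : V → ℕ} {S T : Γ.Subgraph} {a b : V}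

/-- A discrete intermediate value argument: if positions change by one along edges, a connected
subgraph crosses every level between two of its vertices. -/
theorem exists_step (hS : S.Connected) (hadj : ∀ x y, S.Adj x y → d y = d x + 1 ∨ d x = d y + 1)
    (ha : a ∈ S.verts) (hb : b ∈ S.verts) {i : ℕ} (h1 : d a ≤ i) (h2 : i < d b) :
    ∃ x y, S.Adj x y ∧ d x = i ∧ d y = i + 1 := by
  by_contra! hcon
  have : b ∈ {x | d x ≤ i} := subset_of_closed hS ha (X := {x | d x ≤ i}) h1 (by
    intro x y hxy (hx : d x ≤ i)
    have e1 := hadj x y hxy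
    have e2 := hcon x y hxy
    show d y ≤ i
    omega) hb
  have : d b ≤ i := this
  omega

/-- Every unit step between the extreme positions is forced into `T`, and injectivity of `d`
identifies its ends. Hence a connected subgraph is determined by its two extreme vertices. -/
theorem le_of_ends (hd : Function.Injective d) (hT : T.Connected)
    (hSadj : ∀ x y, S.Adj x y → d y = d x + 1 ∨ d x = d y + 1)
    (hTadj : ∀ x y, T.Adj x y → d y = d x + 1 ∨ d x = d y + 1)
    (haT : a ∈ T.verts) (hbT : b ∈ T.verts) (h : ∀ x ∈ S.verts, d a ≤ d x ∧ d x ≤ d b) :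
    S ≤ T := by
  have key : ∀ x y, S.Adj x y → d y = d x + 1 → T.Adj x y := by
    intro x y hxy hxy'
    have h1 := h x (S.edge_vert hxy)
    have h2 := h y (S.edge_vert hxy.symm)
    obtain ⟨x', y', h3, h4, h5⟩ := exists_step hT hTadj haT hbT h1.1 (by omega)
    rwa [← hd h4, ← hd (h5.trans hxy'.symm)]
  constructor
  · intro x hx
    obtain ⟨h1, h2⟩ := h x hx
    rcases h2.eq_or_lt with h2 | h2
    · rwa [hd h2]
    · obtain ⟨x', y', h3, h4, h5⟩ := exists_step hT hTadj haT hbT h1 h2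
      rw [← hd h4]
      exact T.edge_vert h3
  · intro x y hxy
    rcases hSadj x y hxy with h1 | h1
    · exact key x y hxy h1
    · exact (key y x hxy.symm h1).symm

variable [Finite V]

theorem exists_extremal (hS : S.Connected) (d : V → ℕ) :
    ∃ p : V × V, p.1 ∈ S.verts ∧ p.2 ∈ S.verts ∧ ∀ x ∈ S.verts, d p.1 ≤ d x ∧ d x ≤ d p.2 := by
  obtain ⟨a, ha, ha'⟩ := (Set.toFinite S.verts).exists_minimalFor d _ hS.nonempty
  obtain ⟨b, hb, hb'⟩ := (Set.toFinite S.verts).exists_maximalFor d _ hS.nonempty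
  refine ⟨(a, b), ha, hb, fun x hx => ⟨?_, ?_⟩⟩
  · exact (le_total (d a) (d x)).elim id fun h => ha' hx h
  · exact (le_total (d x) (d b)).elim id fun h => hb' hx h

theorem ncard_le_of_rel {α β : Type*} [Finite β] {D : Set α} {E : Set β} (R : α → β → Prop)
    (hex : ∀ s ∈ D, ∃ p ∈ E, R s p) (hinj : ∀ s ∈ D, ∀ t ∈ D, ∀ p, R s p → R t p → s = t) :
    D.ncard ≤ E.ncard := by
  rcases D.eq_empty_or_nonempty with rfl | ⟨s₀, hs₀⟩
  · simp
  have : Nonempty β := ⟨(hex s₀ hs₀).choose⟩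
  choose! g hg using hex
  exact Set.ncard_le_ncard_of_injOn g (fun s hs => (hg s hs).1)
    (fun s hs t ht hst => hinj s hs t ht (g s) (hg s hs).2 (hst ▸ (hg t ht).2)) (Set.toFinite _)

theorem ncard_le_of_extremal (hd : Function.Injective d) {D : Set Γ.Subgraph} {E : Set (V × V)}
    (hD : ∀ S ∈ D, S.Connected ∧ ∀ x y, S.Adj x y → d y = d x + 1 ∨ d x = d y + 1)
    (hE : ∀ S ∈ D, ∀ p : V × V, p.1 ∈ S.verts → p.2 ∈ S.verts →
      (∀ x ∈ S.verts, d p.1 ≤ d x ∧ d x ≤ d p.2) → p ∈ E) : D.ncard ≤ E.ncard := by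
  refine ncard_le_of_rel (fun S p => p.1 ∈ S.verts ∧ p.2 ∈ S.verts ∧
    ∀ x ∈ S.verts, d p.1 ≤ d x ∧ d x ≤ d p.2) ?_ ?_
  · intro S hS
    obtain ⟨p, h1, h2, h3⟩ := exists_extremal (hD S hS).1 d
    exact ⟨p, hE S hS p h1 h2 h3, h1, h2, h3⟩
  · rintro S hS T hT p ⟨h1, h2, h3⟩ ⟨h4, h5, h6⟩
    exact le_antisymm (le_of_ends hd (hD T hT).1 (hD S hS).2 (hD T hT).2 h4 h5 h3)
      (le_of_ends hd (hD S hS).1 (hD T hT).2 (hD S hS).2 h1 h2 h6)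

variable {K : Γ.Subgraph} (hd : Function.Injective d)
  (hK : ∀ x y, K.Adj x y → d y = d x + 1 ∨ d x = d y + 1)

include hd hK

theorem two_mul_connIn_path_le :
    2 * (connIn K).ncard ≤ K.verts.ncard * (K.verts.ncard + 1) := by
  set E : Set (V × V) := {p | p ∈ K.verts ×ˢ K.verts ∧ d p.1 ≤ d p.2} with hE
  have h1 : (connIn K).ncard ≤ E.ncard := by
    refine ncard_le_of_extremal hd (fun S hS => ⟨hS.2, fun x y h => hK x y (hS.1.2 h)⟩) ?_
    exact fun S hS p h1 h2 h3 => ⟨⟨hS.1.1 h1, hS.1.1 h2⟩, (h3 _ h2).1⟩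
  have h2 : (Prod.swap '' E).ncard = E.ncard :=
    Set.ncard_image_of_injective _ Prod.swap_injective
  -- Ordered pairs of ends and their swaps cover at most n² pairs and overlap only on the diagonal,
  -- whence 2|E| ≤ n² + n.
  have h3 := Set.ncard_union_add_ncard_inter E (Prod.swap '' E) (Set.toFinite _) (Set.toFinite _)
  have h4 : (E ∪ Prod.swap '' E).ncard ≤ (K.verts ×ˢ K.verts).ncard := by
    refine Set.ncard_le_ncard ?_ (Set.toFinite _)
    rintro p (h | ⟨q, h, rfl⟩)
    exacts [h.1, ⟨h.1.2, h.1.1⟩]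
  have h5 : (E ∩ Prod.swap '' E).ncard ≤ ((fun x => (x, x)) '' K.verts).ncard := by
    refine Set.ncard_le_ncard ?_ (Set.toFinite _)
    rintro _ ⟨h, ⟨p, q⟩, h', rfl⟩
    have : p = q := hd (le_antisymm h'.2 h.2)
    subst this
    exact ⟨p, h.1.1, rfl⟩
  have h6 := h5.trans (Set.ncard_image_le (Set.toFinite _))
  rw [Set.ncard_prod] at h4
  rw [h2] at h3
  linarith

theorem connAt_path_le (hmin : ∀ x ∈ K.verts, d a ≤ d x) :
    (connAt a K).ncard ≤ K.verts.ncard := by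
  have h1 : (connAt a K).ncard ≤ (Prod.mk a '' K.verts).ncard := by
    refine ncard_le_of_extremal hd (fun S hS => ⟨hS.2.1, fun x y h => hK x y (hS.1.2 h)⟩) ?_
    rintro S hS ⟨p, q⟩ h1 h2 h3
    have : a = p := hd (le_antisymm (hmin p (hS.1.1 h1)) (h3 a hS.2.2).1)
    exact ⟨q, hS.1.1 h2, by rw [this]⟩
  exact h1.trans (Set.ncard_image_le (Set.toFinite _))

theorem connAt_path_le' (hmax : ∀ x ∈ K.verts, d x ≤ d b) :
    (connAt b K).ncard ≤ K.verts.ncard := by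
  have h1 : (connAt b K).ncard ≤ ((fun x => (x, b)) '' K.verts).ncard := by
    refine ncard_le_of_extremal hd (fun S hS => ⟨hS.2.1, fun x y h => hK x y (hS.1.2 h)⟩) ?_
    rintro S hS ⟨p, q⟩ h1 h2 h3
    have : b = q := hd (le_antisymm (h3 b hS.2.2).2 (hmax q (hS.1.1 h2)))
    exact ⟨p, hS.1.1 h1, by rw [this]⟩
  exact h1.trans (Set.ncard_image_le (Set.toFinite _))

theorem connAt_path_ends_le (hmin : ∀ x ∈ K.verts, d a ≤ d x) (hmax : ∀ x ∈ K.verts, d x ≤ d b) :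
    {S ∈ connAt a K | b ∈ S.verts}.ncard ≤ 1 := by
  rw [← Set.ncard_singleton (a, b)]
  refine ncard_le_of_extremal hd (fun S hS => ⟨hS.1.2.1, fun x y h => hK x y (hS.1.1.2 h)⟩) ?_
  rintro S hS ⟨p, q⟩ h1 h2 h3
  have e1 : a = p := hd (le_antisymm (hmin p (hS.1.1.1 h1)) (h3 a hS.1.2.2).1)
  have e2 : b = q := hd (le_antisymm (h3 b hS.2).2 (hmax q (hS.1.1.1 h2)))
  rw [e1, e2]
  rfl

end Path

/-! ### Peeling off a pendant triangle. -/

section Triangle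

variable {K : Γ.Subgraph} {p q b : V}

/-- The deletion of two vertices. -/
abbrev del₂ (K : Γ.Subgraph) (p q : V) : Γ.Subgraph := K.deleteVerts {p, q}

theorem del₂_adj {x y : V} : (del₂ K p q).Adj x y ↔
    K.Adj x y ∧ (x ≠ p ∧ x ≠ q) ∧ (y ≠ p ∧ y ≠ q) := by
  rw [SimpleGraph.Subgraph.deleteVerts_adj]
  simp only [Set.mem_insert_iff, Set.mem_singleton_iff, not_or]
  constructor
  · rintro ⟨_, h1, _, h2, h⟩; exact ⟨h, h1, h2⟩
  · rintro ⟨h, h1, h2⟩; exact ⟨K.edge_vert h, h1, K.edge_vert h.symm, h2, h⟩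

theorem mem_del₂ {x : V} : x ∈ (del₂ K p q).verts ↔ x ∈ K.verts ∧ x ≠ p ∧ x ≠ q := by
  rw [SimpleGraph.Subgraph.deleteVerts_verts, Set.mem_sdiff]
  simp only [Set.mem_insert_iff, Set.mem_singleton_iff, not_or]

theorem del₂_mono {S : Γ.Subgraph} (h : S ≤ K) : del₂ S p q ≤ del₂ K p q :=
  SimpleGraph.Subgraph.deleteVerts_mono h

variable (hp : ∀ x, K.Adj p x → x = q ∨ x = b) (hq : ∀ x, K.Adj q x → x = p ∨ x = b)

include hp hq

/-- A walk from `b` that enters {p, q} can return to the rest only through `b`, so the excursion can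
be cut out. -/
theorem del₂_connected {S : Γ.Subgraph} (hbp : b ≠ p) (hbq : b ≠ q) (hle : S ≤ K)
    (hS : S.Connected) (hb : b ∈ S.verts) : (del₂ S p q).Connected := by
  refine connected_of_root (r := b) (mem_del₂.2 ⟨hb, hbp, hbq⟩) fun x hx => ?_
  obtain ⟨hxS, hxp, hxq⟩ := mem_del₂.1 hx
  have key : ∀ y, ReflTransGen S.Adj b y →
      (y = p ∨ y = q) ∨ ReflTransGen (del₂ S p q).Adj b y := by
    intro y hy
    induction hy with
    | refl => exact Or.inr .refl
    | @tail y z _ hyz ih =>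
      by_cases hz : z = p ∨ z = q
      · exact Or.inl hz
      right
      rcases ih with (rfl | rfl) | ih
      · rcases hp z (hle.2 hyz) with rfl | rfl
        · tauto
        · exact .refl
      · rcases hq z (hle.2 hyz) with rfl | rfl
        · tauto
        · exact .refl
      · by_cases hy : y = p ∨ y = q
        · rcases hy with rfl | rfl
          · rcases hp z (hle.2 hyz) with rfl | rfl
            · tauto
            · exact .refl
          · rcases hq z (hle.2 hyz) with rfl | rfl
            · tauto
            · exact .refl
        · exact ih.tail (del₂_adj.2 ⟨hyz, by tauto, by tauto⟩)
  exact (key x (reach hS hb hxS)).resolve_left (by tauto)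

theorem le_of_codes {S T : Γ.Subgraph} (hbp : b ≠ p) (hbq : b ≠ q) (hSK : S ≤ K)
    (hS : S.Connected) (hbS : b ∈ S.verts) (h : del₂ S p q ≤ del₂ T p q)
    (h1 : S.Adj p b → T.Adj p b) (h2 : S.Adj q b → T.Adj q b) (h3 : S.Adj p q → T.Adj p q) :
    S ≤ T := by
  have hp' : ∀ x, S.Adj p x → T.Adj p x := by
    intro x hx
    rcases hp x (hSK.2 hx) with rfl | rfl
    exacts [h3 hx, h1 hx]
  have hq' : ∀ x, S.Adj q x → T.Adj q x := by
    intro x hx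
    rcases hq x (hSK.2 hx) with rfl | rfl
    exacts [(h3 hx.symm).symm, h2 hx]
  constructor
  · intro x hx
    by_cases hxp : x = p
    · subst hxp
      obtain ⟨z, hz⟩ := exists_adj_of_connected hS hx hbS hbp.symm
      exact T.edge_vert (hp' z hz)
    by_cases hxq : x = q
    · subst hxq
      obtain ⟨z, hz⟩ := exists_adj_of_connected hS hx hbS hbq.symm
      exact T.edge_vert (hq' z hz)
    · exact (mem_del₂.1 (h.1 (mem_del₂.2 ⟨hx, hxp, hxq⟩))).1
  · intro x y hxy
    by_cases hx : x = p ∨ x = q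
    · rcases hx with rfl | rfl
      exacts [hp' y hxy, hq' y hxy]
    by_cases hy : y = p ∨ y = q
    · rcases hy with rfl | rfl
      exacts [(hp' x hxy.symm).symm, (hq' x hxy.symm).symm]
    · exact (del₂_adj.1 (h.2 (del₂_adj.2 ⟨hxy, by tauto, by tauto⟩))).1

variable [Finite V]

/-- The connected subgraphs that meet a pendant triangle in its attaching vertex and in another
vertex are counted by their restriction to the rest of the graph. -/
theorem ncard_triangle_le (hbp : b ≠ p) (hbq : b ≠ q) {D E : Set Γ.Subgraph}
    (hD : ∀ S ∈ D, S ≤ K ∧ S.Connected ∧ b ∈ S.verts ∧ (p ∈ S.verts ∨ q ∈ S.verts))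
    (hE : ∀ S ∈ D, del₂ S p q ∈ E) : D.ncard ≤ 6 * E.ncard := by
  classical
  -- Of the 8 choices among the edges pb, qb, pq, the 2 using neither pb nor qb cannot join `p` or
  -- `q` to `b`; 6 remain.
  set C : Finset (Bool × Bool × Bool) := Finset.univ.filter fun c => c.1 = true ∨ c.2.1 = true
  have hC : (C : Set (Bool × Bool × Bool)).ncard = 6 := by
    rw [Set.ncard_coe_finset]
    decide
  rw [← hC, ← Set.ncard_prod]
  refine Set.ncard_le_ncard_of_injOn
    (fun S => ((decide (S.Adj p b), decide (S.Adj q b), decide (S.Adj p q)), del₂ S p q)) ?_ ?_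
    (Set.toFinite _)
  · intro S hS
    refine ⟨?_, hE S hS⟩
    obtain ⟨h1, h2, h3, h4⟩ := hD S hS
    have : S.Adj p b ∨ S.Adj q b := by
      by_contra! hcon
      have hsub := subset_of_closed h2 (X := {x | x ≠ p ∧ x ≠ q}) h3 ⟨hbp, hbq⟩ (by
        rintro x y hxy ⟨hx1, hx2⟩
        refine ⟨?_, ?_⟩
        · rintro rfl
          rcases hp x (h1.2 hxy.symm) with rfl | rfl
          exacts [hx2 rfl, hcon.1 hxy.symm]
        · rintro rfl
          rcases hq x (h1.2 hxy.symm) with rfl | rfl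
          exacts [hx1 rfl, hcon.2 hxy.symm])
      rcases h4 with h4 | h4
      · exact (hsub h4).1 rfl
      · exact (hsub h4).2 rfl
    simpa [C] using this
  · intro S hS T hT hST
    obtain ⟨h1, h2, h3, _⟩ := hD S hS
    obtain ⟨h5, h6, h7, _⟩ := hD T hT
    simp only [Prod.mk.injEq, decide_eq_decide] at hST
    obtain ⟨⟨e1, e2, e3⟩, e4⟩ := hST
    exact le_antisymm
      (le_of_codes hp hq hbp hbq h1 h2 h3 e4.le e1.1 e2.1 e3.1)
      (le_of_codes hp hq hbp hbq h5 h6 h7 e4.ge e1.2 e2.2 e3.2)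

/-- The three terms count the subgraphs avoiding p and q, those meeting {p, q} but not b (two
vertices and one edge), and those meeting both. -/
theorem connIn_triangle_le (hbp : b ≠ p) (hbq : b ≠ q) (hpq : p ≠ q) : (connIn K).ncard ≤
    (connIn (del₂ K p q)).ncard + 3 + 6 * (connAt b (del₂ K p q)).ncard := by
  classical
  set B := {S | S ∈ connIn K ∧ (p ∈ S.verts ∨ q ∈ S.verts) ∧ b ∉ S.verts} with hB
  set D := {S | S ∈ connIn K ∧ (p ∈ S.verts ∨ q ∈ S.verts) ∧ b ∈ S.verts} with hD
  have h1 : connIn K ⊆ connIn (del₂ K p q) ∪ B ∪ D := by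
    intro S hS
    by_cases h : p ∈ S.verts ∨ q ∈ S.verts
    · by_cases hb : b ∈ S.verts
      · exact Or.inr ⟨hS, h, hb⟩
      · exact Or.inl (Or.inr ⟨hS, h, hb⟩)
    · push Not at h
      refine Or.inl (Or.inl ⟨⟨fun x hx => mem_del₂.2 ⟨hS.1.1 hx, ?_, ?_⟩, fun x y hxy =>
        del₂_adj.2 ⟨hS.1.2 hxy, ⟨?_, ?_⟩, ?_, ?_⟩⟩, hS.2⟩) <;> rintro rfl
      exacts [h.1 hx, h.2 hx, h.1 (S.edge_vert hxy), h.2 (S.edge_vert hxy),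
        h.1 (S.edge_vert hxy.symm), h.2 (S.edge_vert hxy.symm)]
  have hBadj : ∀ S ∈ B, S.verts ⊆ {p, q} ∧ ∀ x y, S.Adj x y →
      (x = p ∧ y = q ∨ x = q ∧ y = p) := by
    rintro S ⟨hS, h, hb⟩
    have hclosed : ∀ x y, S.Adj x y → x ∈ ({p, q} : Set V) → (x = p ∧ y = q ∨ x = q ∧ y = p) := by
      rintro x y hxy (rfl | rfl)
      · rcases hp y (hS.1.2 hxy) with rfl | rfl
        · tauto
        · exact absurd (S.edge_vert hxy.symm) hb
      · rcases hq y (hS.1.2 hxy) with rfl | rfl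
        · tauto
        · exact absurd (S.edge_vert hxy.symm) hb
    have hsub : S.verts ⊆ {p, q} := by
      have hcl : ∀ x y, S.Adj x y → x ∈ ({p, q} : Set V) → y ∈ ({p, q} : Set V) := by
        intro x y hxy hx
        rcases hclosed x y hxy hx with ⟨_, rfl⟩ | ⟨_, rfl⟩
        exacts [Or.inr rfl, Or.inl rfl]
      rcases h with h | h
      · exact subset_of_closed hS.2 h (Or.inl rfl) hcl
      · exact subset_of_closed hS.2 h (Or.inr rfl) hcl
    exact ⟨hsub, fun x y hxy => hclosed x y hxy (hsub (S.edge_vert hxy))⟩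
  have hBpq : ∀ S ∈ B, p ∈ S.verts → q ∈ S.verts → S.Adj p q := by
    intro S hS h h'
    obtain ⟨z, hz⟩ := exists_adj_of_connected hS.1.2 h h' hpq
    rcases (hBadj S hS).2 p z hz with ⟨_, rfl⟩ | ⟨h, _⟩
    exacts [hz, absurd h hpq]
  have hBle : ∀ S ∈ B, ∀ T ∈ B, S.verts ⊆ T.verts → S ≤ T := by
    intro S hS T hT hST
    refine ⟨hST, fun x y hxy => ?_⟩
    have hx := hST (S.edge_vert hxy)
    have hy := hST (S.edge_vert hxy.symm)
    rcases (hBadj S hS).2 x y hxy with ⟨rfl, rfl⟩ | ⟨rfl, rfl⟩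
    exacts [hBpq T hT hx hy, (hBpq T hT hy hx).symm]
  have h2 : B.ncard ≤ 3 := by
    set C : Finset (Bool × Bool) := Finset.univ.filter fun c => c.1 = true ∨ c.2 = true
    have hC : (C : Set (Bool × Bool)).ncard = 3 := by
      rw [Set.ncard_coe_finset]
      decide
    rw [← hC]
    refine Set.ncard_le_ncard_of_injOn
      (fun S => (decide (p ∈ S.verts), decide (q ∈ S.verts))) ?_ ?_ (Set.toFinite _)
    · intro S hS
      simpa [C] using hS.2.1
    · intro S hS T hT hST
      simp only [Prod.mk.injEq, decide_eq_decide] at hST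
      refine le_antisymm (hBle S hS T hT fun x hx => ?_) (hBle T hT S hS fun x hx => ?_)
      · rcases (hBadj S hS).1 hx with rfl | rfl
        exacts [hST.1.1 hx, hST.2.1 hx]
      · rcases (hBadj T hT).1 hx with rfl | rfl
        exacts [hST.1.2 hx, hST.2.2 hx]
  have h3 : D.ncard ≤ 6 * (connAt b (del₂ K p q)).ncard := by
    refine ncard_triangle_le hp hq hbp hbq (fun S hS => ⟨hS.1.1, hS.1.2, hS.2.2, hS.2.1⟩) ?_
    intro S hS
    exact ⟨del₂_mono hS.1.1, del₂_connected hp hq hbp hbq hS.1.1 hS.1.2 hS.2.2,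
      mem_del₂.2 ⟨hS.2.2, hbp, hbq⟩⟩
  have h4 := Set.ncard_le_ncard h1 (Set.toFinite _)
  have h5 := Set.ncard_union_le (connIn (del₂ K p q) ∪ B) D
  have h6 := Set.ncard_union_le (connIn (del₂ K p q)) B
  omega

/-- A connected subgraph through `u` that reaches `p` or `q` must contain `b`. -/
theorem connAt_triangle_le {u : V} (hbp : b ≠ p) (hbq : b ≠ q) (hup : u ≠ p) (huq : u ≠ q) :
    (connAt u K).ncard ≤ (connAt u (del₂ K p q)).ncard +
      6 * {S ∈ connAt u (del₂ K p q) | b ∈ S.verts}.ncard := by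
  set D := {S | S ∈ connAt u K ∧ (p ∈ S.verts ∨ q ∈ S.verts)} with hD
  have hb : ∀ S ∈ D, b ∈ S.verts := by
    rintro S ⟨hS, h⟩
    by_contra hb
    have hcl : ∀ x y, S.Adj x y → x ∈ ({p, q} : Set V) → y ∈ ({p, q} : Set V) := by
      rintro x y hxy (rfl | rfl)
      · rcases hp y (hS.1.2 hxy) with rfl | rfl
        · exact Or.inr rfl
        · exact absurd (S.edge_vert hxy.symm) hb
      · rcases hq y (hS.1.2 hxy) with rfl | rfl
        · exact Or.inl rfl
        · exact absurd (S.edge_vert hxy.symm) hb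
    have hsub : S.verts ⊆ {p, q} := by
      rcases h with h | h
      · exact subset_of_closed hS.2.1 h (Or.inl rfl) hcl
      · exact subset_of_closed hS.2.1 h (Or.inr rfl) hcl
    rcases hsub hS.2.2 with h | h
    exacts [hup h, huq h]
  have h1 : connAt u K ⊆ connAt u (del₂ K p q) ∪ D := by
    intro S hS
    by_cases h : p ∈ S.verts ∨ q ∈ S.verts
    · exact Or.inr ⟨hS, h⟩
    · push Not at h
      refine Or.inl ⟨⟨fun x hx => mem_del₂.2 ⟨hS.1.1 hx, ?_, ?_⟩, fun x y hxy =>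
        del₂_adj.2 ⟨hS.1.2 hxy, ⟨?_, ?_⟩, ?_, ?_⟩⟩, hS.2⟩ <;> rintro rfl
      exacts [h.1 hx, h.2 hx, h.1 (S.edge_vert hxy), h.2 (S.edge_vert hxy),
        h.1 (S.edge_vert hxy.symm), h.2 (S.edge_vert hxy.symm)]
  have h3 : D.ncard ≤ 6 * {S ∈ connAt u (del₂ K p q) | b ∈ S.verts}.ncard := by
    refine ncard_triangle_le hp hq hbp hbq (fun S hS => ⟨hS.1.1, hS.1.2.1, hb S hS, hS.2⟩) ?_
    intro S hS
    exact ⟨⟨del₂_mono hS.1.1, del₂_connected hp hq hbp hbq hS.1.1 hS.1.2.1 (hb S hS),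
      mem_del₂.2 ⟨hS.1.2.2, hup, huq⟩⟩, mem_del₂.2 ⟨hb S hS, hbp, hbq⟩⟩
  have h4 := Set.ncard_le_ncard h1 (Set.toFinite _)
  have h5 := Set.ncard_union_le (connAt u (del₂ K p q)) D
  omega

end Triangle

end CoreIndex

/-! ### Upper bounds for the two extremal graphs. -/

namespace CoreIndex

theorem ncard_del₂ {V : Type*} [Finite V] {Γ : SimpleGraph V} {K : Γ.Subgraph} {p q : V}
    (hp : p ∈ K.verts) (hq : q ∈ K.verts) (hpq : p ≠ q) :
    (del₂ K p q).verts.ncard + 2 = K.verts.ncard := by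
  have h := Set.ncard_sdiff_add_ncard_of_subset (s := {p, q}) (t := K.verts)
    (by rintro x (rfl | rfl) <;> assumption) (Set.toFinite _)
  rwa [Set.ncard_pair hpq] at h

theorem twoCycleGraph_adj {n : ℕ} {i j : Fin n} : (twoCycleGraph 3 3 n).Adj i j ↔
    i ≠ j ∧ ((i.val + 1 = j.val ∨ (i.val = 0 ∧ j.val + 1 = 3) ∨ (i.val + 3 = n ∧ j.val + 1 = n)) ∨
      (j.val + 1 = i.val ∨ (j.val = 0 ∧ i.val + 1 = 3) ∨ (j.val + 3 = n ∧ i.val + 1 = n))) := by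
  rw [twoCycleGraph, SimpleGraph.fromRel_adj]

theorem two_mul_coreIndex_twoCycleGraph_le {n : ℕ} (hn : 6 ≤ n) :
    2 * coreIndex (twoCycleGraph 3 3 n) ≤ n ^ 2 + 17 * n := by
  rw [coreIndex_eq]
  set K : (twoCycleGraph 3 3 n).Subgraph := ⊤ with hK
  obtain ⟨p, hp⟩ : ∃ p : Fin n, p.val = 0 := ⟨⟨0, by omega⟩, rfl⟩
  obtain ⟨q, hq⟩ : ∃ q : Fin n, q.val = 1 := ⟨⟨1, by omega⟩, rfl⟩
  obtain ⟨b, hb⟩ : ∃ b : Fin n, b.val = 2 := ⟨⟨2, by omega⟩, rfl⟩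
  obtain ⟨p', hp'⟩ : ∃ p : Fin n, p.val = n - 1 := ⟨⟨n - 1, by omega⟩, rfl⟩
  obtain ⟨q', hq'⟩ : ∃ q : Fin n, q.val = n - 2 := ⟨⟨n - 2, by omega⟩, rfl⟩
  obtain ⟨b', hb'⟩ : ∃ b : Fin n, b.val = n - 3 := ⟨⟨n - 3, by omega⟩, rfl⟩
  have hadj : ∀ i j, K.Adj i j ↔ (twoCycleGraph 3 3 n).Adj i j := fun i j => Iff.rfl
  have e1 : ∀ x, K.Adj p x → x = q ∨ x = b := by
    intro x hx
    rw [hadj, twoCycleGraph_adj] at hx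
    simp only [Fin.ext_iff, ne_eq] at hx ⊢
    omega
  have e2 : ∀ x, K.Adj q x → x = p ∨ x = b := by
    intro x hx
    rw [hadj, twoCycleGraph_adj] at hx
    simp only [Fin.ext_iff, ne_eq] at hx ⊢
    omega
  have e3 : ∀ x, (del₂ K p q).Adj p' x → x = q' ∨ x = b' := by
    intro x hx
    rw [del₂_adj, hadj, twoCycleGraph_adj] at hx
    simp only [Fin.ext_iff, ne_eq] at hx ⊢
    omega
  have e4 : ∀ x, (del₂ K p q).Adj q' x → x = p' ∨ x = b' := by
    intro x hx
    rw [del₂_adj, hadj, twoCycleGraph_adj] at hx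
    simp only [Fin.ext_iff, ne_eq] at hx ⊢
    omega
  have hne : ∀ {x y : Fin n}, x.val ≠ y.val → x ≠ y := fun h h' => h (congrArg _ h')
  set P := del₂ (del₂ K p q) p' q' with hP
  have hPadj : ∀ x y, P.Adj x y → y.val = x.val + 1 ∨ x.val = y.val + 1 := by
    intro x y hxy
    rw [hP, del₂_adj, del₂_adj, hadj, twoCycleGraph_adj] at hxy
    simp only [Fin.ext_iff, ne_eq] at hxy
    omega
  have hmin : ∀ x ∈ P.verts, b.val ≤ x.val := by
    intro x hx
    rw [hP, mem_del₂, mem_del₂] at hx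
    simp only [Fin.ext_iff, ne_eq] at hx
    omega
  have hmax : ∀ x ∈ P.verts, x.val ≤ b'.val := by
    intro x hx
    rw [hP, mem_del₂, mem_del₂] at hx
    simp only [Fin.ext_iff, ne_eq] at hx
    omega
  have hcard : P.verts.ncard + 4 = n := by
    have h1 : K.verts.ncard = n := by
      rw [hK, SimpleGraph.Subgraph.verts_top, Set.ncard_univ, Nat.card_eq_fintype_card,
        Fintype.card_fin]
    have h2 := ncard_del₂ (K := K) (p := p) (q := q) trivial trivial (hne (by omega))
    have h3 := ncard_del₂ (K := del₂ K p q) (p := p') (q := q')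
      (mem_del₂.2 ⟨trivial, hne (by omega), hne (by omega)⟩)
      (mem_del₂.2 ⟨trivial, hne (by omega), hne (by omega)⟩) (hne (by omega))
    rw [← hP] at h3
    omega
  have f1 := connIn_triangle_le e1 e2 (hne (by omega)) (hne (by omega)) (hne (by omega))
  have f2 := connIn_triangle_le e3 e4 (hne (by omega)) (hne (by omega)) (hne (by omega))
  have f3 := connAt_triangle_le (u := b) e3 e4 (hne (by omega)) (hne (by omega))
    (hne (by omega)) (hne (by omega))
  have hinj : Function.Injective (Fin.val : Fin n → ℕ) := Fin.val_injective
  have f4 := two_mul_connIn_path_le hinj hPadj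
  have f5 := connAt_path_le hinj hPadj hmin
  have f6 := connAt_path_le' hinj hPadj hmax
  have f7 := connAt_path_ends_le hinj hPadj hmin hmax
  rw [← hP] at f2 f3
  obtain ⟨k, rfl⟩ : ∃ k, n = k + 4 := ⟨n - 4, by omega⟩
  have hk : P.verts.ncard = k := by omega
  rw [hk] at f4 f5 f6
  -- With k = n - 4 path vertices the bounds add up to k(k + 1)/2 + (3 + 6k) + (3 + 6(k + 6)), which
  -- equals (n² + 17n)/2.
  nlinarith

theorem cycleGraph_succ_adj {n : ℕ} {u v : Fin (n + 2)} :
    (SimpleGraph.cycleGraph (n + 2)).Adj u v ↔ v = u - 1 ∨ v = u + 1 := by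
  rw [SimpleGraph.cycleGraph_adj, sub_eq_iff_eq_add', sub_eq_iff_eq_add', eq_sub_iff_add_eq]
  constructor
  · rintro (h | h)
    · left; rw [h]
    · right; rw [h]
  · rintro (h | h)
    · left; rw [← h]
    · right; rw [h]

/-- A connected subgraph other than the whole cycle has a vertex s without the edge to s - 1. Cut
there, positions x - s make it a path, determined by s and its last vertex; this leaves at most n²
pairs. -/
theorem coreIndex_cycleGraph_le {n : ℕ} (hn : 3 ≤ n) :
    coreIndex (SimpleGraph.cycleGraph n) ≤ n ^ 2 + 1 := by
  obtain ⟨m, rfl⟩ : ∃ m, n = m + 2 := ⟨n - 2, by omega⟩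
  rw [coreIndex_eq]
  have hcard : (Set.univ : Set (Fin (m + 2) × Fin (m + 2))).ncard = (m + 2) ^ 2 := by
    rw [Set.ncard_univ, Nat.card_eq_fintype_card, Fintype.card_prod, Fintype.card_fin, sq]
  have h1 := Set.ncard_le_ncard_sdiff_add_ncard
    (connIn (⊤ : (SimpleGraph.cycleGraph (m + 2)).Subgraph)) {⊤} (Set.toFinite _)
  rw [Set.ncard_singleton] at h1
  refine h1.trans (Nat.add_le_add_right ?_ 1)
  rw [← hcard]
  refine ncard_le_of_rel (fun S p => p.1 ∈ S.verts ∧ p.2 ∈ S.verts ∧ ¬ S.Adj p.1 (p.1 - 1) ∧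
    ∀ x ∈ S.verts, (x - p.1).val ≤ (p.2 - p.1).val) ?_ ?_
  · rintro S ⟨⟨_, hS⟩, hne⟩
    obtain ⟨s, hs, hs'⟩ : ∃ s ∈ S.verts, ¬ S.Adj s (s - 1) := by
      -- If every vertex of S carried its backward edge, S would go all the way round and be the
      -- whole cycle.
      by_contra! hcon
      refine hne (Set.mem_singleton_iff.2 (top_le_iff.1 ?_))
      obtain ⟨r, hr⟩ := hS.nonempty
      have hall : ∀ (k : ℕ) (x : Fin (m + 2)), (r - x).val = k → x ∈ S.verts := by
        intro k
        induction k with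
        | zero =>
          intro x hx
          rwa [← sub_eq_zero.1 (Fin.ext hx : r - x = 0)]
        | succ k ih =>
          intro x hx
          have h0 : r - x ≠ 0 := fun h => by rw [h] at hx; simp at hx
          have h1 := ih (x + 1) (by
            rw [← sub_sub, Fin.val_sub_one_of_ne_zero h0]
            omega)
          have := S.edge_vert (hcon _ h1).symm
          rwa [add_sub_cancel_right] at this
      have huniv : ∀ x, x ∈ S.verts := fun x => hall _ x rfl
      refine ⟨fun x _ => huniv x, fun x y hxy => ?_⟩
      rcases cycleGraph_succ_adj.1 (show (SimpleGraph.cycleGraph (m + 2)).Adj x y from hxy)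
        with rfl | rfl
      · exact hcon x (huniv x)
      · have := hcon (x + 1) (huniv _)
        rw [add_sub_cancel_right] at this
        exact this.symm
    obtain ⟨p, -, h2, h3⟩ := exists_extremal hS fun x => (x - s).val
    exact ⟨(s, p.2), trivial, hs, h2, hs', fun x hx => (h3 x hx).2⟩
  · rintro S ⟨⟨_, hS⟩, _⟩ T ⟨⟨_, hT⟩, _⟩ ⟨s, b⟩ ⟨h1, h2, h3, h4⟩ ⟨h5, h6, h7, h8⟩
    have hinj : Function.Injective fun x : Fin (m + 2) => (x - s).val := by
      intro x y hxy
      exact sub_left_injective (Fin.val_injective hxy)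
    have hstep : ∀ S : (SimpleGraph.cycleGraph (m + 2)).Subgraph, ¬ S.Adj s (s - 1) →
        ∀ x y, S.Adj x y → (y - s).val = (x - s).val + 1 ∨ (x - s).val = (y - s).val + 1 := by
      intro S hS
      have key : ∀ x, S.Adj x (x + 1) → (x + 1 - s).val = (x - s).val + 1 := by
        intro x hx
        rw [show x + 1 - s = (x - s) + 1 by abel, Fin.val_add_one, if_neg]
        intro hlast
        have : x = s - 1 := by
          have : x - s + 1 = 0 := by rw [hlast]; exact Fin.last_add_one _
          rw [← sub_eq_zero, ← this]
          abel
        subst this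
        rw [sub_add_cancel] at hx
        exact hS hx.symm
      intro x y hxy
      rcases cycleGraph_succ_adj.1 (S.adj_sub hxy) with rfl | rfl
      · right
        have := key (x - 1) (by rw [sub_add_cancel]; exact hxy.symm)
        rwa [sub_add_cancel] at this
      · exact Or.inl (key x hxy)
    refine le_antisymm
      (le_of_ends (a := s) (b := b) hinj hT (hstep S h3) (hstep T h7) h5 h6 ?_)
      (le_of_ends (a := s) (b := b) hinj hS (hstep T h7) (hstep S h3) h1 h2 ?_)
    · exact fun x hx => ⟨by simp, h4 x hx⟩
    · exact fun x hx => ⟨by simp, h8 x hx⟩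

/-! ### The lower bound for `G` and the comparison. -/

section Lower

variable {V : Type*} [Finite V] (G : SimpleGraph V)

/-- The lower bounds are proved inside the complete graph, where contraction stays within one type;
this injection brings them back to `G`. -/
theorem connIn_toSubgraph_le_coreIndex :
    (connIn (SimpleGraph.toSubgraph G (le_top : G ≤ ⊤))).ncard ≤ coreIndex G := by
  let g : (⊤ : SimpleGraph V).Subgraph → G.Subgraph := fun S =>
    { verts := S.verts
      Adj := fun x y => S.Adj x y ∧ G.Adj x y
      adj_sub := fun h => h.2
      edge_vert := fun h => S.edge_vert h.1
      symm := ⟨fun x y h => ⟨h.1.symm, h.2.symm⟩⟩ }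
  refine Set.ncard_le_ncard_of_injOn g (fun S hS => ?_) (fun S hS T hT hST => ?_) (Set.toFinite _)
  · obtain ⟨r, hr⟩ := hS.2.nonempty
    refine connected_of_root (S := g S) (r := r) hr fun x hx => ?_
    exact ReflTransGen.mono (fun _ _ h => ⟨h, hS.1.2 h⟩) _ _ (reach hS.2 hr hx)
  · have hv : (g S).verts = (g T).verts := by rw [hST]
    have ha : ∀ x y, (g S).Adj x y ↔ (g T).Adj x y := fun x y => by rw [hST]
    ext x y
    · exact (Set.ext_iff.1 hv x)
    · exact ⟨fun h => ((ha x y).1 ⟨h, hS.1.2 h⟩).1, fun h => ((ha x y).2 ⟨h, hT.1.2 h⟩).1⟩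

variable {G}

/-- The lower bound for connected graphs of minimum degree at least two. -/
theorem le_coreIndex (hG : G.Connected) (hn : 3 ≤ Nat.card V)
    (hdeg : ∀ x, 2 ≤ (G.neighborSet x).ncard) :
    Nat.card V ^ 2 + 1 ≤ coreIndex G ∨
      (6 ≤ Nat.card V ∧ Nat.card V ^ 2 + 17 * Nat.card V ≤ 2 * coreIndex G) ∨
      (Nat.card V = 4 ∧ 17 ≤ coreIndex G) ∨ (Nat.card V = 5 ∧ 54 ≤ coreIndex G) := by
  have hle := connIn_toSubgraph_le_coreIndex G
  set K : (⊤ : SimpleGraph V).Subgraph := SimpleGraph.toSubgraph G le_top with hK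
  have hc : K.Connected := SimpleGraph.Connected.toSubgraph le_top hG
  have hcard : K.verts.ncard = Nat.card V := Set.ncard_univ V
  have hdeg' : ∀ x ∈ K.verts, 2 ≤ (K.neighborSet x).ncard := fun x _ => hdeg x
  have h1 := sum_degrees_le hdeg' ∅ (by simp)
  simp only [Finset.sum_empty, Finset.card_empty] at h1
  have h2 := darts_even K
  rcases (show 2 * K.verts.ncard ≤ (darts K).ncard by omega).eq_or_lt with h | h
  · have := sq_add_one_le_connIn hc hdeg' h.symm
    rw [hcard] at this
    omega
  have h3 := ncard_le_sq_of_darts K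
  rcases (show 3 ≤ K.verts.ncard by omega).eq_or_lt with h4 | h4
  · rw [← h4] at h3 h
    omega
  by_cases h5 : K.verts.ncard = 4
  · have := seventeen_le_connIn hc h5 (by omega)
    omega
  by_cases h6 : K.verts.ncard = 5
  · obtain ⟨L, hL, hLc, hLv, hLd⟩ := exists_bicyclic hc (by omega)
    have := le_connIn_of_five hLc (by rw [hLv, h6]) (by omega)
    have := ncard_connIn_mono hL
    omega
  · have := le_connIn_of_bicyclic hc (by omega) (by omega)
    rw [hcard] at this
    exact Or.inr (Or.inl ⟨by omega, this.trans (Nat.mul_le_mul_left 2 hle)⟩)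

end Lower

end CoreIndex

theorem theorem5p14 (n : ℕ) (hn : 3 ≤ n) {V : Type*} [Fintype V] (hV : Fintype.card V = n)
    (G : SimpleGraph V) [DecidableRel G.Adj] (hconn : G.Connected)
    (hpend : ∀ v : V, ¬ IsPendant G v) :
    (n ≤ 16 → coreIndex (SimpleGraph.cycleGraph n) ≤ coreIndex G) ∧
    (16 < n → coreIndex (twoCycleGraph 3 3 n) ≤ coreIndex G) ∧
    min ((n : ℚ) ^ 2 + 1) (((n : ℚ) ^ 2 + 17 * (n : ℚ)) / 2) ≤ (coreIndex G : ℚ) := by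
  have hcard : Nat.card V = n := by rw [Nat.card_eq_fintype_card, hV]
  have hdeg : ∀ x, 2 ≤ (G.neighborSet x).ncard := by
    intro x
    have h1 : G.degree x ≠ 1 := hpend x
    have : Nontrivial V := Fintype.one_lt_card_iff_nontrivial.1 (by omega)
    have h2 : 0 < G.degree x := hconn.preconnected.degree_pos_of_nontrivial x
    rw [← Nat.card_coe_set_eq, Nat.card_eq_fintype_card, SimpleGraph.card_neighborSet_eq_degree]
    omega
  have key : n ^ 2 + 1 ≤ coreIndex G ∨ n ^ 2 + 17 * n ≤ 2 * coreIndex G := by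
    have := CoreIndex.le_coreIndex hconn (by omega) hdeg
    rw [hcard] at this
    rcases this with h | ⟨_, h⟩ | ⟨rfl, h⟩ | ⟨rfl, h⟩
    · exact Or.inl h
    · exact Or.inr h
    -- For n = 4 and n = 5 the values 17 and 54 are at least n² + 1.
    · exact Or.inl (by omega)
    · exact Or.inl (by omega)
  refine ⟨fun h16 => ?_, fun h16 => ?_, ?_⟩
  · refine (CoreIndex.coreIndex_cycleGraph_le hn).trans ?_
    rcases key with h | h
    · exact h
    -- 2(n² + 1) ≤ n² + 17n means n² - 17n + 2 ≤ 0, which holds for 3 ≤ n ≤ 16 and reverses from n =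
    -- 17 on.
    · nlinarith
  · have := CoreIndex.two_mul_coreIndex_twoCycleGraph_le (n := n) (by omega)
    rcases key with h | h
    · nlinarith
    · omega
  · rcases key with h | h
    · exact (min_le_left _ _).trans (by exact_mod_cast h)
    · refine (min_le_right _ _).trans ?_
      have : (n : ℚ) ^ 2 + 17 * n ≤ 2 * (coreIndex G : ℚ) := by exact_mod_cast h
      linarith
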